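/- Let $A$ be an associative unital ring (for instance an algebra over a commutative ring $K$), and let $(C,\Delta,\varepsilon)$ be an $A$-coring: an $A$-bimodule with coassociative and counital bimodule maps $\Delta:C\to C\otimes_A C$ and $\varepsilon:C\to A$. Suppose that, as a left $C$-comodule, $C=\bigoplus_{E\in\mathcal E}E$ for a family $\mathcal E$ of left subcomodules such that every ${}_AE$ is a finitely generated projective left $A$-module. Let $B={}^{C}\mathrm{End}(C)$ be the ring of left $C$-comodule endomorphisms of $C$, with the opposite of composition as multiplication; it is an $A$-ring through $a\mapsto(c\mapsto ca)$. Consider the canonical form $\langle c,f\rangle=\varepsilon(f(c))$ on $C\times B$, which is a right rational pairing: $b\mapsto\langle -,b\rangle$ is a ring anti-homomorphism from $B$ to the left dual convolution ring ${}^*C=\mathrm{Hom}({}_AC,{}_AA)$, with product $(f*g)(c)=\sum f(c_{(1)}g(c_{(2)}))$, and for every right $A$-module $X$ the map $X\otimes_AC\to\mathrm{Hom}(B_A,X_A)$, $x\otimes c\mapsto(b\mapsto x\langle c,b\rangle)$, is injective. For a right $B$-module $X$, let $\mathrm{Rat}(X)$ be the $B$-submodule of all $x\in X$ for which there are finitely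 many $c_i\in C$, $x_i\in X$ with $xb=\sum_i x_i\langle c_i,b\rangle$ for all $b\in B$; $X$ is called rational if $\mathrm{Rat}(X)=X$. Let $\mathfrak a=\mathrm{Rat}(B_B)$, a two-sided ideal of $B$. For $E\in\mathcal E$ let $\pi_E:C\to E$ and $\iota_E:E\to C$ be the canonical projection and inclusion, and let $e_E=\iota_E\circ\pi_E\in B$. The left dual ${}^*E=\mathrm{Hom}({}_AE,{}_AA)$ is a right $C$-comodule with coaction $\theta\mapsto\sum_i x_i^*\otimes(C\otimes_A\theta)\lambda_E(x_i)$, where $(x_i,x_i^*)$ is a finite dual basis of $E$ and $\lambda_E$ is the coaction of $E$. Put $\Sigma=\bigoplus_{E}{}^*E$, let $T=\mathrm{End}_C(\Sigma)$ be its ring of right $C$-comodule endomorphisms (with composition as multiplication), let $u_E\in T$ be the idempotent projecting onto ${}^*E$, and let $R=\bigoplus_{E,F}u_E\,T\,u_F\subseteq T$, a ring with enough idempotents. Regard $\Sigma$ as contained in ${}^*C$ through $(\theta_E)_E\mapsto\sum_E\theta_E\circ\pi_E$. Then: (a) $R$ is a rational right $B$-module injected in $\mathfrak a$. Precisely, there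 are a right $B$-module structure on $R$ for which $R$ is rational and an injective right $B$-linear map $j:R\to\mathfrak a$; this $j$ is multiplicative and is the canonical map induced by the duality $E\mapsto{}^*E$, that is, $r(\theta)=\theta\circ j(r)$ in ${}^*C$ for all $r\in R$ and $\theta\in\Sigma$. (b) $\mathfrak a=\sum_{E\in\mathcal E}B\,e_E\,B$, and $\mathfrak a$ is a pure left $B$-submodule of $B$, that is, $X\otimes_B\mathfrak a\to X\otimes_BB$ is injective for every right $B$-module $X$. (c) The functor $\mathrm{Rat}$ from right $B$-modules to right $B$-modules is exact. -/

import Mathlib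

open scoped DirectSum

namespace NCoring

open MulOpposite

/-! ## Tensor products over a noncommutative ring

Right modules over `A` are modules over `Aᵐᵒᵖ`; an `A`-bimodule carries commuting structures over
`A` and `Aᵐᵒᵖ`.  -/

section Tensor

variable (A : Type*) [Ring A]
variable (M : Type*) [AddCommGroup M] [Module Aᵐᵒᵖ M]
variable (N : Type*) [AddCommGroup N] [Module A N]

/-- The relations `ma ⊗ n = m ⊗ an`. -/
def balancedRel : AddSubgroup (TensorProduct ℤ M N) :=
  AddSubgroup.closure {t | ∃ (m : M) (a : A) (n : N),
    t = TensorProduct.tmul ℤ (op a • m) n - TensorProduct.tmul ℤ m (a • n)}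

/-- The tensor product `M ⊗_A N` of a right module `M` and a left module `N`. -/
def NTensor : Type _ := TensorProduct ℤ M N ⧸ balancedRel A M N

instance : AddCommGroup (NTensor A M N) :=
  inferInstanceAs (AddCommGroup (TensorProduct ℤ M N ⧸ balancedRel A M N))

namespace NTensor

variable {M N}

/-- The quotient map from the tensor product over the integers. -/
def proj : TensorProduct ℤ M N →+ NTensor A M N := QuotientAddGroup.mk' (balancedRel A M N)

/-- The pure tensor `m ⊗ n` in `M ⊗_A N`. -/
def tmul (m : M) (n : N) : NTensor A M N := proj A (TensorProduct.tmul ℤ m n)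

theorem add_tmul (m m' : M) (n : N) : tmul A (m + m') n = tmul A m n + tmul A m' n := by
  simp only [tmul, TensorProduct.add_tmul, map_add]

theorem tmul_add (m : M) (n n' : N) : tmul A m (n + n') = tmul A m n + tmul A m n' := by
  simp only [tmul, TensorProduct.tmul_add, map_add]

theorem op_smul_tmul (a : A) (m : M) (n : N) : tmul A (op a • m) n = tmul A m (a • n) := by
  rw [← sub_eq_zero, tmul, tmul, ← map_sub]
  exact (QuotientAddGroup.eq_zero_iff _).2 (AddSubgroup.subset_closure ⟨m, a, n, rfl⟩)

@[simp] theorem zero_tmul (n : N) : tmul A (0 : M) n = 0 := by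
  rw [tmul, TensorProduct.zero_tmul, map_zero]

@[simp] theorem tmul_zero (m : M) : tmul A m (0 : N) = 0 := by
  rw [tmul, TensorProduct.tmul_zero, map_zero]

variable (M N)

/-- The biadditive map `(m, n) ↦ m ⊗ n`. -/
def mk : M →+ N →+ NTensor A M N :=
  AddMonoidHom.mk' (fun m => AddMonoidHom.mk' (fun n => tmul A m n) (tmul_add A m))
    (fun m m' => AddMonoidHom.ext fun n => add_tmul A m m' n)

variable {M N}

@[simp] theorem mk_apply (m : M) (n : N) : mk A M N m n = tmul A m n := rfl

@[elab_as_elim]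
theorem induction_on {p : NTensor A M N → Prop} (t : NTensor A M N)
    (tm : ∀ m n, p (tmul A m n)) (add : ∀ s t, p s → p t → p (s + t)) : p t := by
  obtain ⟨t, rfl⟩ := QuotientAddGroup.mk'_surjective _ t
  induction t using TensorProduct.induction_on with
  | zero =>
    have := tm 0 0
    rw [tmul, TensorProduct.zero_tmul] at this
    exact this
  | tmul m n => exact tm m n
  | add s t hs ht =>
    rw [map_add]
    exact add _ _ hs ht

theorem hom_ext {P : Type*} [AddCommGroup P] {f g : NTensor A M N →+ P}
    (h : ∀ m n, f (tmul A m n) = g (tmul A m n)) : f = g := by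
  ext t
  induction t using induction_on with
  | tm m n => exact h m n
  | add s t hs ht => rw [map_add, map_add, hs, ht]

/-- The universal property: balanced biadditive maps factor through `M ⊗_A N`. -/
def lift {P : Type*} [AddCommGroup P] (f : M →+ N →+ P)
    (hf : ∀ (m : M) (a : A) (n : N), f (op a • m) n = f m (a • n)) : NTensor A M N →+ P :=
  QuotientAddGroup.lift (balancedRel A M N)
    (TensorProduct.liftAddHom f (fun r m n => by simp))
    (by
      rw [balancedRel, AddSubgroup.closure_le]
      rintro _ ⟨m, a, n, rfl⟩
      simp [hf])

@[simp] theorem lift_tmul {P : Type*} [AddCommGroup P] (f : M →+ N →+ P)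
    (hf : ∀ (m : M) (a : A) (n : N), f (op a • m) n = f m (a • n)) (m : M) (n : N) :
    lift A f hf (tmul A m n) = f m n := rfl

/-- `f ⊗_A g`. -/
def map {M' : Type*} [AddCommGroup M'] [Module Aᵐᵒᵖ M'] {N' : Type*} [AddCommGroup N']
    [Module A N'] (f : M →ₗ[Aᵐᵒᵖ] M') (g : N →ₗ[A] N') : NTensor A M N →+ NTensor A M' N' :=
  lift A (((mk A M' N').compl₂ g.toAddMonoidHom).comp f.toAddMonoidHom)
    (fun m a n => by simp [op_smul_tmul])

@[simp] theorem map_tmul {M' : Type*} [AddCommGroup M'] [Module Aᵐᵒᵖ M'] {N' : Type*}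
    [AddCommGroup N'] [Module A N'] (f : M →ₗ[Aᵐᵒᵖ] M') (g : N →ₗ[A] N') (m : M) (n : N) :
    map A f g (tmul A m n) = tmul A (f m) (g n) := rfl

/-- If `M` is a bimodule then `M ⊗_A N` is a left module: `a (m ⊗ n) = am ⊗ n`. -/
instance leftModule [Module A M] [SMulCommClass A Aᵐᵒᵖ M] : Module A (NTensor A M N) where
  smul a t := map A (Module.toModuleEnd Aᵐᵒᵖ (S := A) M a) (LinearMap.id : N →ₗ[A] N) t
  one_smul t := by
    change map A _ _ t = t
    induction t using induction_on with
    | tm m n => simp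
    | add s t hs ht => rw [map_add, hs, ht]
  mul_smul a b t := by
    change map A _ _ t = map A _ _ (map A _ _ t)
    induction t using induction_on with
    | tm m n => simp [mul_smul]
    | add s t hs ht => simp only [map_add, hs, ht]
  smul_zero a := map_zero (map A _ _)
  smul_add a := map_add (map A _ _)
  add_smul a b t := by
    change map A _ _ t = map A _ _ t + map A _ _ t
    induction t using induction_on with
    | tm m n => simp [add_smul, add_tmul]
    | add s t hs ht => rw [map_add, hs, ht, map_add, map_add]; abel
  zero_smul t := by
    change map A _ _ t = 0
    induction t using induction_on with
    | tm m n => simp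
    | add s t hs ht => rw [map_add, hs, ht, add_zero]

@[simp] theorem smul_tmul [Module A M] [SMulCommClass A Aᵐᵒᵖ M] (a : A) (m : M) (n : N) :
    a • tmul A m n = tmul A (a • m) n := rfl

/-- If `N` is a bimodule then `M ⊗_A N` is a right module: `(m ⊗ n) a = m ⊗ na`. -/
instance rightModule [Module Aᵐᵒᵖ N] [SMulCommClass A Aᵐᵒᵖ N] :
    Module Aᵐᵒᵖ (NTensor A M N) where
  smul a t := map A (LinearMap.id : M →ₗ[Aᵐᵒᵖ] M)
    (haveI := SMulCommClass.symm A Aᵐᵒᵖ N; Module.toModuleEnd A (S := Aᵐᵒᵖ) N a) t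
  one_smul t := by
    change map A _ _ t = t
    induction t using induction_on with
    | tm m n => simp
    | add s t hs ht => rw [map_add, hs, ht]
  mul_smul a b t := by
    change map A _ _ t = map A _ _ (map A _ _ t)
    induction t using induction_on with
    | tm m n => simp [mul_smul]
    | add s t hs ht => simp only [map_add, hs, ht]
  smul_zero a := map_zero (map A _ _)
  smul_add a := map_add (map A _ _)
  add_smul a b t := by
    change map A _ _ t = map A _ _ t + map A _ _ t
    induction t using induction_on with
    | tm m n => simp [add_smul, tmul_add]
    | add s t hs ht => rw [map_add, hs, ht, map_add, map_add]; abel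
  zero_smul t := by
    change map A _ _ t = 0
    induction t using induction_on with
    | tm m n => simp
    | add s t hs ht => rw [map_add, hs, ht, add_zero]

@[simp] theorem rsmul_tmul [Module Aᵐᵒᵖ N] [SMulCommClass A Aᵐᵒᵖ N] (a : Aᵐᵒᵖ) (m : M) (n : N) :
    a • tmul A m n = tmul A m (a • n) := rfl

variable (M N)

/-- The associativity map `(M ⊗_A N) ⊗_A P → M ⊗_A (N ⊗_A P)`. -/
def assoc [Module Aᵐᵒᵖ N] [SMulCommClass A Aᵐᵒᵖ N] (P : Type*) [AddCommGroup P] [Module A P] :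
    NTensor A (NTensor A M N) P →+ NTensor A M (NTensor A N P) :=
  lift A
    (lift A
      (AddMonoidHom.mk' (fun m => (AddMonoidHom.compHom (mk A M (NTensor A N P) m)).comp (mk A N P))
        (fun m m' => by ext n p; simp))
      (fun m a n => by ext p; simp [op_smul_tmul]))
    (fun t a p => by
      induction t using induction_on with
      | tm m n => simp [op_smul_tmul]
      | add s t hs ht => simp only [smul_add, map_add, AddMonoidHom.add_apply, hs, ht])

variable {M N}

@[simp] theorem assoc_tmul [Module Aᵐᵒᵖ N] [SMulCommClass A Aᵐᵒᵖ N] {P : Type*} [AddCommGroup P]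
    [Module A P] (m : M) (n : N) (p : P) :
    assoc A M N P (tmul A (tmul A m n) p) = tmul A m (tmul A n p) := rfl

variable (M N)

/-- The unit map `A ⊗_A N → N`, `a ⊗ n ↦ an`. -/
def lid : NTensor A A N →+ N :=
  lift A (AddMonoidHom.mk' (fun a => DistribSMul.toAddMonoidHom N a)
    (fun a b => by ext n; simp [add_smul])) (fun a b n => by simp [mul_smul])

/-- The unit map `M ⊗_A A → M`, `m ⊗ a ↦ ma`. -/
def rid : NTensor A M A →+ M :=
  lift A (AddMonoidHom.mk'
      (fun m => AddMonoidHom.mk' (fun a => op a • m) (fun a b => by simp [add_smul]))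
      (fun m m' => by ext n; simp))
    (fun m a b => by simp [mul_smul])

variable {M N}

@[simp] theorem lid_tmul (a : A) (n : N) : lid A N (tmul A a n) = a • n := rfl

@[simp] theorem rid_tmul (m : M) (a : A) : rid A M (tmul A m a) = op a • m := rfl

end NTensor

namespace NTensor

variable {A M N}

theorem map_id_smul [Module A M] [SMulCommClass A Aᵐᵒᵖ M] {N' : Type*} [AddCommGroup N']
    [Module A N'] (g : N →ₗ[A] N') (a : A) (t : NTensor A M N) :
    map A LinearMap.id g (a • t) = a • map A (LinearMap.id : M →ₗ[Aᵐᵒᵖ] M) g t := by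
  induction t using induction_on with
  | tm m n => simp
  | add s t hs ht => simp only [smul_add, map_add, hs, ht]

theorem map_rsmul_id [Module Aᵐᵒᵖ N] [SMulCommClass A Aᵐᵒᵖ N] {M' : Type*} [AddCommGroup M']
    [Module Aᵐᵒᵖ M'] (f : M →ₗ[Aᵐᵒᵖ] M') (a : Aᵐᵒᵖ) (t : NTensor A M N) :
    map A f LinearMap.id (a • t) = a • map A f (LinearMap.id : N →ₗ[A] N) t := by
  induction t using induction_on with
  | tm m n => simp
  | add s t hs ht => simp only [smul_add, map_add, hs, ht]

theorem rid_smul [Module A M] [SMulCommClass A Aᵐᵒᵖ M] (a : A) (t : NTensor A M A) :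
    rid A M (a • t) = a • rid A M t := by
  induction t using induction_on with
  | tm m n => simp [smul_comm]
  | add s t hs ht => simp only [smul_add, map_add, hs, ht]

/-- `f ⊗_A N` as a right linear map. -/
def mapRight (N : Type*) [AddCommGroup N] [Module A N] [Module Aᵐᵒᵖ N] [SMulCommClass A Aᵐᵒᵖ N]
    {M' : Type*} [AddCommGroup M'] [Module Aᵐᵒᵖ M'] (f : M →ₗ[Aᵐᵒᵖ] M') :
    NTensor A M N →ₗ[Aᵐᵒᵖ] NTensor A M' N where
  toFun := map A f LinearMap.id
  map_add' := map_add _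
  map_smul' := map_rsmul_id f

theorem map_map {M' : Type*} [AddCommGroup M'] [Module Aᵐᵒᵖ M'] {N' : Type*} [AddCommGroup N']
    [Module A N'] {M'' : Type*} [AddCommGroup M''] [Module Aᵐᵒᵖ M''] {N'' : Type*}
    [AddCommGroup N''] [Module A N''] (f : M →ₗ[Aᵐᵒᵖ] M') (g : N →ₗ[A] N')
    (f' : M' →ₗ[Aᵐᵒᵖ] M'') (g' : N' →ₗ[A] N'') (t : NTensor A M N) :
    map A f' g' (map A f g t) = map A (f' ∘ₗ f) (g' ∘ₗ g) t := by
  induction t using induction_on with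
  | tm m n => simp
  | add s t hs ht => simp only [map_add, hs, ht]

@[simp] theorem map_id (t : NTensor A M N) :
    map A (LinearMap.id : M →ₗ[Aᵐᵒᵖ] M) (LinearMap.id : N →ₗ[A] N) t = t := by
  induction t using induction_on with
  | tm m n => simp
  | add s t hs ht => simp only [map_add, hs, ht]

end NTensor

end Tensor

/-- A left submodule `L` of a left `B`-module `N` is pure if `X ⊗_B L → X ⊗_B N` is injective for
every right `B`-module `X`. -/
def IsPure.{x, y, z} {B : Type y} [Ring B] {N : Type z} [AddCommGroup N] [Module B N]
    (L : Submodule B N) : Prop :=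
  ∀ (X : Type x) [AddCommGroup X] [Module Bᵐᵒᵖ X],
    Function.Injective (NTensor.map B (LinearMap.id : X →ₗ[Bᵐᵒᵖ] X) L.subtype)

/-! ## Corings and comodules -/

/-- A homomorphism of bimodules. -/
structure BimodHom (A : Type*) [Ring A] (M N : Type*) [AddCommGroup M] [Module A M]
    [Module Aᵐᵒᵖ M] [AddCommGroup N] [Module A N] [Module Aᵐᵒᵖ N] where
  /-- the underlying left linear map -/
  left : M →ₗ[A] N
  left_op_smul : ∀ (a : Aᵐᵒᵖ) (m : M), left (a • m) = a • left m

/-- The right linear map underlying a homomorphism of bimodules. -/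
def BimodHom.right {A : Type*} [Ring A] {M N : Type*} [AddCommGroup M] [Module A M]
    [Module Aᵐᵒᵖ M] [AddCommGroup N] [Module A N] [Module Aᵐᵒᵖ N] (f : BimodHom A M N) :
    M →ₗ[Aᵐᵒᵖ] N where
  toFun := f.left
  map_add' := map_add f.left
  map_smul' := f.left_op_smul

@[simp] theorem BimodHom.right_apply {A : Type*} [Ring A] {M N : Type*} [AddCommGroup M]
    [Module A M] [Module Aᵐᵒᵖ M] [AddCommGroup N] [Module A N] [Module Aᵐᵒᵖ N]
    (f : BimodHom A M N) (m : M) : f.right m = f.left m := rfl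

open NTensor in
/-- `A`-corings. -/
class Coring (A : Type*) [Ring A] (C : Type*) [AddCommGroup C] [Module A C] [Module Aᵐᵒᵖ C]
    [SMulCommClass A Aᵐᵒᵖ C] where
  /-- the comultiplication `C → C ⊗_A C` -/
  comul : BimodHom A C (NTensor A C C)
  /-- the counit `C → A` -/
  counit : BimodHom A C A
  coassoc : ∀ c, assoc A C C C (map A comul.right LinearMap.id (comul.left c)) =
    map A LinearMap.id comul.left (comul.left c)
  counit_left : ∀ c, lid A C (map A counit.right LinearMap.id (comul.left c)) = c
  counit_right : ∀ c, rid A C (map A LinearMap.id counit.left (comul.left c)) = c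

section Comodules

variable (A : Type*) [Ring A] (C : Type*) [AddCommGroup C] [Module A C] [Module Aᵐᵒᵖ C]
  [SMulCommClass A Aᵐᵒᵖ C] [Coring A C]

open NTensor Coring

/-- Left comodules over the `A`-coring `C`. -/
class LeftComodule (M : Type*) [AddCommGroup M] [Module A M] where
  /-- the coaction `M → C ⊗_A M` -/
  coact : M →ₗ[A] NTensor A C M
  coact_coassoc : ∀ m, assoc A C C M (map A (comul (A := A) (C := C)).right LinearMap.id (coact m)) =
    map A LinearMap.id coact (coact m)
  coact_counit : ∀ m, lid A M (map A (counit (A := A) (C := C)).right LinearMap.id (coact m)) = m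

/-- Right comodules over the `A`-coring `C`. -/
class RightComodule (M : Type*) [AddCommGroup M] [Module Aᵐᵒᵖ M] where
  /-- the coaction `M → M ⊗_A C` -/
  coact : M →ₗ[Aᵐᵒᵖ] NTensor A M C
  coact_coassoc : ∀ m, assoc A M C C (map A coact LinearMap.id (coact m)) =
    map A LinearMap.id (comul (A := A) (C := C)).left (coact m)
  coact_counit : ∀ m, rid A M (map A LinearMap.id (counit (A := A) (C := C)).left (coact m)) = m

/-- `C` as a left comodule over itself. -/
instance selfLeftComodule : LeftComodule A C C where
  coact := (comul (A := A) (C := C)).left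
  coact_coassoc := coassoc
  coact_counit := counit_left

/-- Morphisms of left comodules. -/
def IsLeftColinear {M N : Type*} [AddCommGroup M] [Module A M] [LeftComodule A C M]
    [AddCommGroup N] [Module A N] [LeftComodule A C N] (f : M →ₗ[A] N) : Prop :=
  ∀ m, LeftComodule.coact (A := A) (C := C) (f m) =
    map A LinearMap.id f (LeftComodule.coact (A := A) (C := C) m)

/-- Morphisms of right comodules. -/
def IsRightColinear {M N : Type*} [AddCommGroup M] [Module Aᵐᵒᵖ M] [RightComodule A C M]
    [AddCommGroup N] [Module Aᵐᵒᵖ N] [RightComodule A C N] (f : M →ₗ[Aᵐᵒᵖ] N) : Prop :=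
  ∀ m, RightComodule.coact (A := A) (C := C) (f m) =
    map A f LinearMap.id (RightComodule.coact (A := A) (C := C) m)

end Comodules


/-! ## The right comodule structure on the left dual of a profinite left comodule -/

section Dual

variable (A : Type*) [Ring A]

/-- The left dual `*P = Hom_A(P, A)`, a right `A`-module by `(θ a)(x) = θ(x) a`. -/
abbrev LeftDual (P : Type*) [AddCommGroup P] [Module A P] : Type _ := P →ₗ[A] A

variable {A} {P : Type*} [AddCommGroup P] [Module A P]

open NTensor

theorem exists_dualBasis [Module.Finite A P] [Module.Projective A P] :
    ∃ (n : ℕ) (e : Fin n → P) (f : Fin n → LeftDual A P), ∀ x, ∑ i, f i x • e i = x := by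
  obtain ⟨n, f, g, -, -, h⟩ := Module.Finite.exists_comp_eq_id_of_projective A P
  refine ⟨n, fun i => f (Pi.single i 1), fun i => LinearMap.proj i ∘ₗ g, fun x => ?_⟩
  have hx : f (g x) = x := LinearMap.congr_fun h x
  have hs : ∑ i, g x i • (Pi.single i 1 : Fin n → A) = g x := by
    ext j
    simp [Finset.sum_apply, Pi.single_apply]
  conv_rhs => rw [← hx, ← hs]
  simp

/-- Evaluation at `x`: the map `*P ⊗_A N → N`, `θ ⊗ n ↦ θ(x) n`. -/
def evalAt (N : Type*) [AddCommGroup N] [Module A N] (x : P) : NTensor A (LeftDual A P) N →+ N :=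
  lift A (AddMonoidHom.mk' (fun θ => DistribSMul.toAddMonoidHom N (θ x))
    (fun θ θ' => by ext n; simp [add_smul])) (fun θ a n => by simp [mul_smul])

@[simp] theorem evalAt_tmul {N : Type*} [AddCommGroup N] [Module A N] (x : P) (θ : LeftDual A P)
    (n : N) : evalAt N x (tmul A θ n) = θ x • n := rfl

theorem evalAt_smul {N : Type*} [AddCommGroup N] [Module A N] [Module Aᵐᵒᵖ N]
    [SMulCommClass A Aᵐᵒᵖ N] (a : Aᵐᵒᵖ) (x : P) (t : NTensor A (LeftDual A P) N) :
    evalAt N x (a • t) = a • evalAt N x t := by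
  induction t using induction_on with
  | tm m n => simp [smul_comm]
  | add s t hs ht => simp only [map_add, hs, ht, smul_add]

theorem evalAt_map {N N' : Type*} [AddCommGroup N] [Module A N] [AddCommGroup N'] [Module A N']
    (g : N →ₗ[A] N') (x : P) (t : NTensor A (LeftDual A P) N) :
    evalAt N' x (map A LinearMap.id g t) = g (evalAt N x t) := by
  induction t using induction_on with
  | tm m n => simp
  | add s t hs ht => simp only [map_add, hs, ht]

theorem evalAt_ext [Module.Finite A P] [Module.Projective A P] {N : Type*} [AddCommGroup N]
    [Module A N] {s t : NTensor A (LeftDual A P) N} (h : ∀ x, evalAt N x s = evalAt N x t) :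
    s = t := by
  obtain ⟨n, e, f, hef⟩ := exists_dualBasis (A := A) (P := P)
  have key : ∀ t : NTensor A (LeftDual A P) N, t = ∑ i, tmul A (f i) (evalAt N (e i) t) := by
    intro t
    induction t using induction_on with
    | tm θ y =>
      have : θ = ∑ i, op (θ (e i)) • f i := by
        ext x
        conv_lhs => rw [← hef x]
        simp
      conv_lhs => rw [this, ← mk_apply, map_sum]
      simp [op_smul_tmul]
    | add s t hs ht =>
      conv_lhs => rw [hs, ht]
      simp [tmul_add, Finset.sum_add_distrib]
  rw [key s, key t]
  simp [h]

variable (C : Type*) [AddCommGroup C] [Module A C] [Module Aᵐᵒᵖ C]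
  [SMulCommClass A Aᵐᵒᵖ C]

/-- For `θ ∈ *P`, the map `C ⊗_A θ : C ⊗_A P → C`, `c ⊗ x ↦ c θ(x)`. -/
def contract (θ : LeftDual A P) : NTensor A C P →ₗ[A] C where
  toFun t := rid A C (map A LinearMap.id θ t)
  map_add' x y := by simp only [map_add]
  map_smul' a x := by simp only [map_id_smul, rid_smul, RingHom.id_apply]

@[simp] theorem contract_tmul (θ : LeftDual A P) (c : C) (x : P) :
    contract C θ (tmul A c x) = op (θ x) • c := rfl

variable [Coring A C]

/-- For a left comodule `P` with coaction `λ` and `θ ∈ *P`, the map `(C ⊗_A θ) ∘ λ : P → C`. -/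
def hat [LeftComodule A C P] (θ : LeftDual A P) : P →ₗ[A] C :=
  contract C θ ∘ₗ LeftComodule.coact (A := A) (C := C)

theorem hat_add [LeftComodule A C P] (θ θ' : LeftDual A P) :
    hat C (θ + θ') = hat C θ + hat C θ' := by
  ext x
  simp only [hat, LinearMap.comp_apply, LinearMap.add_apply]
  generalize LeftComodule.coact (A := A) (C := C) x = t
  induction t using induction_on with
  | tm m n => simp [add_smul]
  | add s t hs ht => simp only [map_add, hs, ht]; abel

theorem hat_smul [LeftComodule A C P] (a : Aᵐᵒᵖ) (θ : LeftDual A P) (x : P) :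
    hat C (a • θ) x = a • hat C θ x := by
  simp only [hat, LinearMap.comp_apply]
  generalize LeftComodule.coact (A := A) (C := C) x = t
  induction t using induction_on with
  | tm m n => simp [mul_smul]
  | add s t hs ht => simp only [map_add, hs, ht, smul_add]

variable [LeftComodule A C P]

theorem map_id_hat (θ : LeftDual A P) (x : P) :
    map A LinearMap.id (hat C θ) (LeftComodule.coact (A := A) (C := C) x) =
      (Coring.comul (A := A) (C := C)).left (hat C θ x) := by
  have h1 : ∀ t : NTensor A C P, map A (LinearMap.id : C →ₗ[Aᵐᵒᵖ] C) (contract C θ)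
      (assoc A C C P (map A (Coring.comul (A := A) (C := C)).right LinearMap.id t)) =
      (Coring.comul (A := A) (C := C)).left (contract C θ t) := by
    intro t
    induction t using induction_on with
    | tm c p =>
      rw [map_tmul, contract_tmul, BimodHom.left_op_smul, BimodHom.right_apply]
      generalize (Coring.comul (A := A) (C := C)).left c = s
      induction s using induction_on with
      | tm c c' => simp
      | add s t hs ht => simp only [add_tmul, map_add, hs, ht, smul_add]
    | add s t hs ht => simp only [map_add, hs, ht]
  have h2 := h1 (LeftComodule.coact (A := A) (C := C) x)
  rw [LeftComodule.coact_coassoc, map_map] at h2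
  exact h2

variable [Module.Finite A P] [Module.Projective A P]

variable (A P) in
/-- The coaction `θ ↦ ∑ eᵢ* ⊗ (C ⊗ θ)(λ(eᵢ))` on `*P`, for a finite dual basis `(eᵢ, eᵢ*)`; it is
independent of the dual basis. -/
noncomputable def dualCoact (θ : LeftDual A P) : NTensor A (LeftDual A P) C :=
  ∑ i, tmul A ((exists_dualBasis (A := A) (P := P)).choose_spec.choose_spec.choose i)
    (hat C θ ((exists_dualBasis (A := A) (P := P)).choose_spec.choose i))

@[simp] theorem evalAt_dualCoact (θ : LeftDual A P) (x : P) :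
    evalAt C x (dualCoact A P C θ) = hat C θ x := by
  have := (exists_dualBasis (A := A) (P := P)).choose_spec.choose_spec.choose_spec x
  conv_rhs => rw [← this]
  simp [dualCoact]

/-- The left dual of a profinite left comodule is a right comodule. -/
noncomputable instance dualRightComodule : RightComodule A C (LeftDual A P) where
  coact :=
    { toFun := dualCoact A P C
      map_add' := fun θ θ' => evalAt_ext fun x => by simp [hat_add]
      map_smul' := fun a θ => evalAt_ext fun x => by simp [hat_smul, evalAt_smul] }
  coact_coassoc θ := by
    refine evalAt_ext fun x => ?_
    rw [evalAt_map]
    simp only [LinearMap.coe_mk, AddHom.coe_mk, evalAt_dualCoact]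
    have h1 : ∀ (s : NTensor A (LeftDual A P) C) (c : C),
        evalAt _ x (assoc A _ C C (tmul A s c)) = tmul A (evalAt C x s) c := by
      intro s c
      induction s using induction_on with
      | tm m n => simp
      | add s t hs ht => simp only [map_add, add_tmul, hs, ht]
    rw [← map_id_hat, dualCoact, map_sum, map_sum, map_sum]
    simp only [map_tmul, h1, LinearMap.coe_mk, AddHom.coe_mk, LinearMap.id_apply, evalAt_dualCoact]
    simp only [hat, LinearMap.comp_apply]
    generalize LeftComodule.coact (A := A) (C := C) x = t
    induction t using induction_on with
    | tm c p =>
      have h3 := (exists_dualBasis (A := A) (P := P)).choose_spec.choose_spec.choose_spec p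
      conv_rhs => rw [← h3]
      simp only [contract_tmul, map_tmul, op_smul_tmul, LinearMap.id_apply, map_sum, map_smul,
        LinearMap.comp_apply]
      simp only [← mk_apply, map_sum]
    | add s t hs ht => simp only [map_add, add_tmul, Finset.sum_add_distrib, hs, ht]
  coact_counit θ := by
    ext x
    have h1 : ∀ t : NTensor A (LeftDual A P) A, rid A (LeftDual A P) t x = evalAt A x t := by
      intro t
      induction t using induction_on with
      | tm m n => simp
      | add s t hs ht => simp only [map_add, LinearMap.add_apply, hs, ht]
    rw [h1, evalAt_map]
    simp only [LinearMap.coe_mk, AddHom.coe_mk, evalAt_dualCoact]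
    have h2 := congrArg θ (LeftComodule.coact_counit (A := A) (C := C) x)
    rw [← h2]
    simp only [hat, LinearMap.comp_apply]
    generalize LeftComodule.coact (A := A) (C := C) x = t
    induction t using induction_on with
    | tm m n => simp [← BimodHom.right_apply]
    | add s t hs ht => simp only [map_add, hs, ht]

end Dual

/-! ## Direct sums of right comodules and the ring `R` -/

section DirectSums

variable (A : Type*) [Ring A] (C : Type*) [AddCommGroup C] [Module A C] [Module Aᵐᵒᵖ C]
  [SMulCommClass A Aᵐᵒᵖ C] [Coring A C]

open NTensor Coring

/-- The ring of endomorphisms of a right comodule (multiplication is composition). -/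
def rightEnd (S : Type*) [AddCommGroup S] [Module Aᵐᵒᵖ S] [RightComodule A C S] :
    Subring (Module.End Aᵐᵒᵖ S) where
  carrier := {f | IsRightColinear A C f}
  one_mem' x := (map_id _).symm
  zero_mem' x := by
    simp only [LinearMap.zero_apply, map_zero]
    generalize RightComodule.coact (A := A) (C := C) x = t
    induction t using induction_on with
    | tm m n => simp
    | add s t hs ht => rw [map_add, ← hs, ← ht, add_zero]
  mul_mem' {f g} hf hg x := by
    rw [Module.End.mul_apply, hf, hg, map_map]
    rfl
  add_mem' {f g} hf hg x := by
    rw [LinearMap.add_apply, map_add, hf, hg]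
    generalize RightComodule.coact (A := A) (C := C) x = t
    induction t using induction_on with
    | tm m n => simp [add_tmul]
    | add s t hs ht => rw [map_add, map_add, map_add, ← hs, ← ht]; abel
  neg_mem' {f} hf x := by
    rw [LinearMap.neg_apply, map_neg, hf]
    generalize RightComodule.coact (A := A) (C := C) x = t
    induction t using induction_on with
    | tm m n =>
      rw [neg_eq_iff_add_eq_zero]
      simp [← add_tmul]
    | add s t hs ht => rw [map_add, map_add, ← hs, ← ht]; abel

variable {ι : Type*} [DecidableEq ι] (M : ι → Type*) [∀ i, AddCommGroup (M i)]
  [∀ i, Module Aᵐᵒᵖ (M i)]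

/-- The idempotent `u_i` of the endomorphism ring of `⨁ M_i`: projection onto `M_i` followed by
inclusion. -/
def unitIdem (i : ι) : Module.End Aᵐᵒᵖ (⨁ i, M i) :=
  DirectSum.lof Aᵐᵒᵖ ι M i ∘ₗ DirectSum.component Aᵐᵒᵖ ι M i

variable [∀ i, RightComodule A C (M i)]

/-- The coaction on a direct sum of right comodules. -/
def sumCoact : (⨁ i, M i) →ₗ[Aᵐᵒᵖ] NTensor A (⨁ i, M i) C :=
  DirectSum.toModule Aᵐᵒᵖ ι _ fun i =>
    mapRight C (DirectSum.lof Aᵐᵒᵖ ι M i) ∘ₗ RightComodule.coact (A := A) (C := C)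

theorem sumCoact_lof (i : ι) (m : M i) :
    sumCoact A C M (DirectSum.lof Aᵐᵒᵖ ι M i m) =
      map A (DirectSum.lof Aᵐᵒᵖ ι M i) LinearMap.id (RightComodule.coact (A := A) (C := C) m) := by
  rw [sumCoact, DirectSum.toModule_lof]
  rfl

/-- A direct sum of right comodules is a right comodule. -/
instance sumRightComodule : RightComodule A C (⨁ i, M i) where
  coact := sumCoact A C M
  coact_coassoc x := by
    induction x using DirectSum.induction_on with
    | zero => simp only [map_zero]
    | of i m =>
      change assoc A _ C C (map A _ _ (sumCoact A C M (DirectSum.lof Aᵐᵒᵖ ι M i m))) =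
        map A _ _ (sumCoact A C M (DirectSum.lof Aᵐᵒᵖ ι M i m))
      rw [sumCoact_lof, map_map, map_map]
      have h := congrArg (map A (DirectSum.lof Aᵐᵒᵖ ι M i) LinearMap.id)
        (RightComodule.coact_coassoc (A := A) (C := C) m)
      rw [map_map] at h
      refine Eq.trans ?_ h
      generalize RightComodule.coact (A := A) (C := C) m = t
      induction t using induction_on with
      | tm m n =>
        simp only [map_tmul, LinearMap.comp_apply, sumCoact_lof, LinearMap.id_apply]
        generalize RightComodule.coact (A := A) (C := C) m = t
        induction t using induction_on with
        | tm m n => simp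
        | add s t hs ht => simp only [map_add, add_tmul, hs, ht]
      | add s t hs ht => simp only [map_add, hs, ht]
    | add x y hx hy => simp only [map_add, hx, hy]
  coact_counit x := by
    induction x using DirectSum.induction_on with
    | zero => simp only [map_zero]
    | of i m =>
      change rid A _ (map A _ _ (sumCoact A C M (DirectSum.lof Aᵐᵒᵖ ι M i m))) =
        DirectSum.lof Aᵐᵒᵖ ι M i m
      conv_rhs => rw [← RightComodule.coact_counit (A := A) (C := C) m]
      rw [sumCoact_lof, map_map]
      generalize RightComodule.coact (A := A) (C := C) m = t
      induction t using induction_on with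
      | tm m n => simp
      | add s t hs ht => simp only [map_add, hs, ht]
    | add x y hx hy => simp only [map_add, hx, hy]

theorem unitIdem_mem (i : ι) : unitIdem A M i ∈ rightEnd A C (⨁ i, M i) := by
  intro x
  change sumCoact A C M _ = map A _ _ (sumCoact A C M x)
  induction x using DirectSum.induction_on with
  | zero => simp only [map_zero]
  | of j m =>
    change sumCoact A C M (unitIdem A M i (DirectSum.lof Aᵐᵒᵖ ι M j m)) =
      map A _ _ (sumCoact A C M (DirectSum.lof Aᵐᵒᵖ ι M j m))
    rw [sumCoact_lof, map_map]
    by_cases h : j = i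
    · subst h
      have : unitIdem A M j ∘ₗ DirectSum.lof Aᵐᵒᵖ ι M j = DirectSum.lof Aᵐᵒᵖ ι M j := by
        ext1 y
        simp [unitIdem, DirectSum.component.lof_self]
      rw [this, ← LinearMap.comp_apply (unitIdem A M j), this, sumCoact_lof]
      rfl
    · have : unitIdem A M i ∘ₗ DirectSum.lof Aᵐᵒᵖ ι M j = 0 := by
        ext1 y
        simp [unitIdem, DirectSum.component.of, h]
      rw [this, ← LinearMap.comp_apply (unitIdem A M i), this]
      simp only [LinearMap.zero_apply, map_zero]
      generalize RightComodule.coact (A := A) (C := C) m = t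
      induction t using induction_on with
      | tm m n => simp
      | add s t hs ht => rw [map_add, ← hs, ← ht, add_zero]
  | add x y hx hy => simp only [map_add, hx, hy]

/-- The ring with enough idempotents `R = ⨁_{i,j} u_j T u_i`, where `T` is the ring of comodule
endomorphisms of `Σ = ⨁ M_i`: the (nonunital) subring of `T` of all finite sums of elements
`u_j t u_i`. -/
def idemRing : NonUnitalSubring (Module.End Aᵐᵒᵖ (⨁ i, M i)) where
  __ := AddSubgroup.closure {r : Module.End Aᵐᵒᵖ (⨁ i, M i) | ∃ i j : ι,
    ∃ t ∈ rightEnd A C (⨁ i, M i), r = unitIdem A M j * t * unitIdem A M i}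
  mul_mem' {r s} hr hs := by
    change r * s ∈ AddSubgroup.closure _
    induction hr using AddSubgroup.closure_induction with
    | zero => rw [zero_mul]; exact zero_mem _
    | add x y _ _ hx hy => rw [add_mul]; exact add_mem hx hy
    | neg x _ hx => exact (congrArg (· ∈ AddSubgroup.closure _) (neg_mul x s)).mpr (neg_mem hx)
    | mem x hx =>
      obtain ⟨i, j, t, ht, rfl⟩ := hx
      induction hs using AddSubgroup.closure_induction with
      | zero => rw [mul_zero]; exact zero_mem _
      | add x y _ _ hx hy => rw [mul_add]; exact add_mem hx hy
      | neg x _ hx =>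
        exact (congrArg (· ∈ AddSubgroup.closure _) (mul_neg _ x)).mpr (neg_mem hx)
      | mem x hx =>
        obtain ⟨i', j', t', ht', rfl⟩ := hx
        refine AddSubgroup.subset_closure ⟨i', j,
          t * (unitIdem A M i * (unitIdem A M j' * t')), ?_, by simp only [mul_assoc]⟩
        exact mul_mem ht (mul_mem (unitIdem_mem A C M i) (mul_mem (unitIdem_mem A C M j') ht'))

end DirectSums

/-! ## Rational pairings and rational modules -/

section Pairings

variable (A : Type*) [Ring A] (C : Type*) [AddCommGroup C] [Module A C] [Module Aᵐᵒᵖ C]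
  [SMulCommClass A Aᵐᵒᵖ C]

open NTensor Coring

/-- An `A`-ring `B` (a ring homomorphism `A → B`) with a balanced `A`-bilinear form
`C × B → A`. -/
structure BalancedForm (B : Type*) [Ring B] where
  /-- the structure map of the `A`-ring `B` -/
  unit : A →+* B
  /-- the form -/
  form : C →+ B →+ A
  form_smul : ∀ a c b, form (a • c) b = a * form c b
  form_balanced : ∀ a c b, form (op a • c) b = form c (unit a * b)
  form_mul_unit : ∀ c b a, form c (b * unit a) = form c b * a

variable {A C}

/-- The map `β_A : B → *C`, `b ↦ ⟨-, b⟩`. -/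
def BalancedForm.beta {B : Type*} [Ring B] (P : BalancedForm A C B) (b : B) : LeftDual A C where
  toFun c := P.form c b
  map_add' c c' := by simp
  map_smul' a c := P.form_smul a c b

/-- The maps `α_X : X ⊗_A C → Hom(B, X)`, `x ⊗ c ↦ (b ↦ x ⟨c, b⟩)`. -/
def BalancedForm.alpha {B : Type*} [Ring B] (P : BalancedForm A C B) (X : Type*) [AddCommGroup X]
    [Module Aᵐᵒᵖ X] : NTensor A X C →+ (B →+ X) :=
  lift A
    (AddMonoidHom.mk' (fun x => AddMonoidHom.mk' (fun c => AddMonoidHom.mk'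
        (fun b => op (P.form c b) • x) (fun b b' => by simp [add_smul]))
        (fun c c' => by ext b; simp [add_smul]))
      (fun x x' => by ext c b; simp))
    (fun x a c => by ext b; simp [P.form_smul, mul_smul])

/-- The product of the left dual convolution ring `*C`: `(f * g)(c) = f(c₁ g(c₂))`. -/
def convolution [Coring A C] (f g : LeftDual A C) : LeftDual A C :=
  f ∘ₗ hat C g

variable (A C) in
/-- Balanced forms for which `β_A : B → *C` is a ring anti-homomorphism. -/
structure Pairing [Coring A C] (B : Type*) [Ring B] extends BalancedForm A C B where
  beta_one : toBalancedForm.beta 1 = (counit (A := A) (C := C)).left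
  beta_mul : ∀ b b', toBalancedForm.beta (b * b') =
    convolution (toBalancedForm.beta b') (toBalancedForm.beta b)

/-- Right rational pairings: `α_X` is injective for every right `A`-module `X`. -/
def Pairing.IsRightRational.{x, y, z, t} {A : Type y} [Ring A] {C : Type z} [AddCommGroup C]
    [Module A C] [Module Aᵐᵒᵖ C] [SMulCommClass A Aᵐᵒᵖ C] [Coring A C] {B : Type t} [Ring B]
    (P : Pairing A C B) : Prop :=
  ∀ (X : Type x) [AddCommGroup X] [Module Aᵐᵒᵖ X], Function.Injective (P.alpha X)

variable [Coring A C] {B : Type*} [Ring B] (P : Pairing A C B)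

/-- The element `x` has right rational parameters `(cᵢ, yᵢ)`: `x b = ∑ yᵢ ⟨cᵢ, b⟩` for all `b`. -/
def Pairing.IsRational {X : Type*} [AddCommGroup X] [Module Bᵐᵒᵖ X] (x : X) : Prop :=
  ∃ (n : ℕ) (c : Fin n → C) (y : Fin n → X),
    ∀ b : B, op b • x = ∑ i, op (P.unit (P.form (c i) b)) • y i

/-- The rational submodule of a right `B`-module. -/
def Pairing.rat (X : Type*) [AddCommGroup X] [Module Bᵐᵒᵖ X] : Submodule Bᵐᵒᵖ X where
  carrier := {x | P.IsRational x}
  zero_mem' := ⟨0, Fin.elim0, Fin.elim0, fun b => by simp⟩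
  add_mem' := by
    rintro x x' ⟨n, c, y, h⟩ ⟨n', c', y', h'⟩
    exact ⟨n + n', Fin.append c c', Fin.append y y', fun b => by
      simp [Fin.sum_univ_add, h, h']⟩
  smul_mem' := by
    rintro b' x ⟨n, c, y, h⟩
    refine ⟨n, fun i => hat C (P.beta b'.unop) (c i), y, fun b => ?_⟩
    have : op b • b' • x = op (b'.unop * b) • x := by rw [op_mul, mul_smul, op_unop]
    rw [this, h]
    refine Finset.sum_congr rfl fun i _ => ?_
    congr 3
    exact LinearMap.congr_fun (P.beta_mul b'.unop b) (c i)

theorem Pairing.IsRational.map {X Y : Type*} [AddCommGroup X] [Module Bᵐᵒᵖ X] [AddCommGroup Y]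
    [Module Bᵐᵒᵖ Y] (f : X →ₗ[Bᵐᵒᵖ] Y) {x : X} (hx : P.IsRational x) : P.IsRational (f x) := by
  obtain ⟨n, c, y, h⟩ := hx
  exact ⟨n, c, fun i => f (y i), fun b => by rw [← map_smul, h, map_sum]; simp⟩

open CategoryTheory in
/-- The right rational functor on right `B`-modules. -/
def Pairing.ratFunctor.{x, y, z, t} {A : Type y} [Ring A] {C : Type z} [AddCommGroup C]
    [Module A C] [Module Aᵐᵒᵖ C] [SMulCommClass A Aᵐᵒᵖ C] [Coring A C] {B : Type t} [Ring B]
    (P : Pairing A C B) : ModuleCat.{x} Bᵐᵒᵖ ⥤ ModuleCat.{x} Bᵐᵒᵖ where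
  obj X := ModuleCat.of Bᵐᵒᵖ (P.rat X)
  map {X Y} f := ModuleCat.ofHom
    (f.hom.restrict (p := P.rat X) (q := P.rat Y) fun _ hx => Pairing.IsRational.map P f.hom hx)

instance : P.ratFunctor.Additive where

/-- The rational ideal of `B`: the rational part of `B` as a right module over itself, as a left
ideal. It is two-sided by the instance below. -/
def Pairing.rationalIdeal : Ideal B where
  carrier := P.rat B
  zero_mem' := zero_mem _
  add_mem' := add_mem
  smul_mem' b _ hx := Pairing.IsRational.map P (X := B) (Y := B)
    { toFun := fun x => b * x
      map_add' := mul_add b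
      map_smul' := fun b' x => (mul_assoc b x b'.unop).symm } hx

instance : P.rationalIdeal.IsTwoSided where
  mul_mem_of_left b hx := (P.rat B).smul_mem (op b) hx

end Pairings

/-! ## The canonical pairing with the endomorphism ring of the left comodule `C` -/

section Canonical

variable (A : Type*) [Ring A] (C : Type*) [AddCommGroup C] [Module A C] [Module Aᵐᵒᵖ C]
  [SMulCommClass A Aᵐᵒᵖ C] [Coring A C]

open NTensor Coring

/-- The ring of endomorphisms of the left comodule `C`, with the opposite of composition as
multiplication. -/
def leftEnd : Subring (Module.End A C)ᵐᵒᵖ where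
  carrier := {f | IsLeftColinear A C f.unop}
  one_mem' x := (map_id _).symm
  zero_mem' x := by
    simp only [unop_zero, LinearMap.zero_apply, map_zero]
    generalize LeftComodule.coact (A := A) (C := C) x = t
    induction t using induction_on with
    | tm m n => simp
    | add s t hs ht => rw [map_add, ← hs, ← ht, add_zero]
  mul_mem' {f g} hf hg x := by
    rw [unop_mul, Module.End.mul_apply, hg, hf, map_map]
    rfl
  add_mem' {f g} hf hg x := by
    rw [unop_add, LinearMap.add_apply, map_add, hf, hg]
    generalize LeftComodule.coact (A := A) (C := C) x = t
    induction t using induction_on with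
    | tm m n => simp [tmul_add]
    | add s t hs ht => rw [map_add, map_add, map_add, ← hs, ← ht]; abel
  neg_mem' {f} hf x := by
    rw [unop_neg, LinearMap.neg_apply, map_neg, hf]
    generalize LeftComodule.coact (A := A) (C := C) x = t
    induction t using induction_on with
    | tm m n =>
      rw [neg_eq_iff_add_eq_zero]
      simp [← tmul_add]
    | add s t hs ht => rw [map_add, map_add, ← hs, ← ht]; abel

variable {A C}

/-- The endomorphism of `C` underlying an element of the endomorphism ring. -/
def leftEnd.toEnd (b : leftEnd A C) : C →ₗ[A] C := b.1.unop

variable (A C)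

/-- Right multiplication by `a` as a left linear map. -/
def rightMul (a : A) : C →ₗ[A] C where
  toFun c := op a • c
  map_add' := smul_add _
  map_smul' b c := (smul_comm b (op a) c).symm

theorem rightMul_colinear (a : A) : IsLeftColinear A C (rightMul A C a) := by
  intro c
  change (comul (A := A) (C := C)).left (op a • c) = map A _ _ ((comul (A := A) (C := C)).left c)
  rw [BimodHom.left_op_smul]
  rfl

/-- The ring homomorphism from `A` given by right multiplications. -/
def rightMulHom : A →+* leftEnd A C where
  toFun := fun a => ⟨op (rightMul A C a), rightMul_colinear A C a⟩
  map_one' := by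
    apply Subtype.ext; apply unop_injective; ext c
    simp [rightMul]
  map_mul' := fun a b => by
    apply Subtype.ext; apply unop_injective; ext c
    simp [rightMul, mul_smul]
  map_zero' := by
    apply Subtype.ext; apply unop_injective; ext c
    simp [rightMul]
  map_add' := fun a b => by
    apply Subtype.ext; apply unop_injective; ext c
    simp [rightMul, add_smul]

variable {A C} in
theorem toEnd_apply_eq_hat (b : leftEnd A C) (c : C) :
    leftEnd.toEnd b c = hat C ((counit (A := A) (C := C)).left ∘ₗ leftEnd.toEnd b) c := by
  conv_lhs => rw [← Coring.counit_right (A := A) (leftEnd.toEnd b c)]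
  have h2 : (comul (A := A) (C := C)).left (leftEnd.toEnd b c) =
    map A LinearMap.id (leftEnd.toEnd b) ((comul (A := A) (C := C)).left c) := b.2 c
  rw [h2, map_map]
  rfl

/-- The form `⟨c, f⟩ = ε(f(c))`. -/
def canonicalForm : C →+ leftEnd A C →+ A :=
  AddMonoidHom.mk' (fun c => AddMonoidHom.mk'
      (fun f => (counit (A := A) (C := C)).left (leftEnd.toEnd f c))
      (fun f g => by simp [leftEnd.toEnd]))
    (fun c c' => by ext f; simp only [map_add]; rfl)

theorem canonicalForm_apply (c : C) (f : leftEnd A C) :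
    canonicalForm A C c f = (counit (A := A) (C := C)).left (leftEnd.toEnd f c) := rfl

/-- The canonical pairing: `⟨c, f⟩ = ε(f(c))`, where `A` maps to the endomorphism ring by right
multiplications. -/
def canonicalPairing : Pairing A C (leftEnd A C) where
  unit := rightMulHom A C
  form := canonicalForm A C
  form_smul a c b := by
    rw [canonicalForm_apply, canonicalForm_apply, map_smul, map_smul, smul_eq_mul]
  form_balanced a c b := rfl
  form_mul_unit c b a := (counit (A := A) (C := C)).left_op_smul (op a) (leftEnd.toEnd b c)
  beta_one := rfl
  beta_mul b b' := by
    ext c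
    change (counit (A := A) (C := C)).left (leftEnd.toEnd b' (leftEnd.toEnd b c)) = _
    rw [toEnd_apply_eq_hat b c]
    rfl

end Canonical

/-! ## Direct sum decompositions of `C` into left subcomodules -/

section Decomposition

variable {A : Type*} [Ring A] {C : Type*} [AddCommGroup C] [Module A C]
  {ι : Type*} [DecidableEq ι] {E : ι → Submodule A C} (hdec : DirectSum.IsInternal E)

theorem internal_bijective (hdec : DirectSum.IsInternal E) :
    Function.Bijective (DirectSum.coeLinearMap E) := hdec

/-- The projection of `C = ⨁ E_i` onto `E_i`. -/
noncomputable def projTo (i : ι) : C →ₗ[A] E i :=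
  DirectSum.component A ι (fun i => E i) i ∘ₗ
    (LinearEquiv.ofBijective (DirectSum.coeLinearMap E)
      (internal_bijective hdec)).symm.toLinearMap

theorem projTo_self (i : ι) (x : E i) : projTo hdec i x = x := by
  have : (LinearEquiv.ofBijective (DirectSum.coeLinearMap E)
      (internal_bijective hdec)).symm (x : C) =
      DirectSum.lof A ι (fun i => E i) i x := by
    rw [LinearEquiv.symm_apply_eq]
    simp
  simp only [projTo, LinearMap.comp_apply, LinearEquiv.coe_coe, this]
  exact DirectSum.component.lof_self ..

theorem projTo_ne {i j : ι} (h : j ≠ i) (x : E j) : projTo hdec i x = 0 := by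
  have : (LinearEquiv.ofBijective (DirectSum.coeLinearMap E)
      (internal_bijective hdec)).symm (x : C) =
      DirectSum.lof A ι (fun i => E i) j x := by
    rw [LinearEquiv.symm_apply_eq]
    simp
  simp only [projTo, LinearMap.comp_apply, LinearEquiv.coe_coe, this]
  simp [DirectSum.component.of, h]

/-- The identification of `⨁ *E_i` with a submodule of `*C`: `(θ_i) ↦ ∑ θ_i ∘ π_i`. -/
noncomputable def toDual : (⨁ i, LeftDual A (E i)) →+ LeftDual A C :=
  DirectSum.toAddMonoid fun i => AddMonoidHom.mk' (fun θ => θ ∘ₗ projTo hdec i)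
    (fun _ _ => LinearMap.add_comp _ _ _)

variable [Module Aᵐᵒᵖ C] [SMulCommClass A Aᵐᵒᵖ C] [Coring A C] [∀ i, LeftComodule A C (E i)]
  (hsub : ∀ i, IsLeftColinear A C (E i).subtype)

open NTensor Coring

theorem projTo_colinear (hdec : DirectSum.IsInternal E)
    (hsub : ∀ i, IsLeftColinear A C (E i).subtype) (i : ι) :
    IsLeftColinear A C ((E i).subtype ∘ₗ projTo hdec i) := by
  intro c
  obtain ⟨c, rfl⟩ := hdec.2 c
  induction c using DirectSum.induction_on with
  | zero => simp only [map_zero]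
  | of j x =>
    rw [DirectSum.coeAddMonoidHom_of]
    have h := hsub j x
    rw [Submodule.subtype_apply] at h
    rw [h, map_map]
    by_cases hij : j = i
    · subst hij
      have h3 : ((E j).subtype ∘ₗ projTo hdec j) ∘ₗ (E j).subtype = (E j).subtype := by
        ext y
        simp [projTo_self]
      rw [h3, LinearMap.comp_apply, projTo_self]
      exact hsub j x
    · have h3 : ((E i).subtype ∘ₗ projTo hdec i) ∘ₗ (E j).subtype = 0 := by
        ext y
        simp [projTo_ne hdec hij]
      rw [h3, LinearMap.comp_apply, projTo_ne hdec hij, map_zero, map_zero]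
      generalize LeftComodule.coact (A := A) (C := C) x = t
      induction t using induction_on with
      | tm m n => simp
      | add s t hs ht => rw [map_add, ← hs, ← ht, add_zero]
  | add x y hx hy => simp only [map_add, hx, hy]

/-- The idempotent `e_i = ι_i ∘ π_i` of the endomorphism ring of the left comodule `C`. -/
noncomputable def decIdem (i : ι) : leftEnd A C :=
  ⟨op ((E i).subtype ∘ₗ projTo hdec i), projTo_colinear hdec hsub i⟩

end Decomposition

end NCoring

open NCoring

universe w

/-! Everything rests on one criterion: for a finite set `F` of indices put `e_F = ∑_{i ∈ F} e_i`;
then an element `x` of a right `B`-module is rational if and only if `x e_F = x` for some `F`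
(`isRational_iff`). If `x b = ∑ yₖ⟨cₖ, b⟩`, the finitely many `cₖ` lie in a finite subsum of `C = ⨁
E_i`, where `e_F` acts as the identity, so `e_F` and `1` act alike on `x`. Conversely, a finite dual
basis of `E_i` provides rational parameters for `e_i`, so `e_F` lies in the rational ideal `𝔞`, and
every `x e_F` is rational.

Parts (b) and (c) follow because the `e_F` are local right units for rational elements. An element
of `𝔞` equals `x e_F`, hence lies in the ideal generated by the `e_i`. An element of `X ⊗_B 𝔞` can
be rewritten as `x ⊗ e_F`, where `x` is its image in `X ⊗_B B = X`, which gives purity. Multiplying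
a lift of a rational element by `e_F` makes the lift rational, which gives exactness.

For (a), finitely generated projective modules are reflexive, so colinear maps `E_j → E_i`
correspond to colinear maps `*E_i → *E_j`. Thus `u_j T u_i` is dual to the corner `e_j B e_i`. The
relation `r(θ) = θ ∘ b` (`IsDualTo`) is additive, multiplicative and injective on both sides, and
the elements `b` dual to members of `R` form a right ideal inside `𝔞`; the module structure on `R`
is transported from there.

The pairing is rational because `C` is projective, so functionals separate `X ⊗_A C`, and because
every functional on `C` has the form `⟨-, b⟩`. -/

namespace NCoring

open MulOpposite NTensor Coring

/-! ## The canonical pairing is rational -/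

section Rational

variable {A : Type*} [Ring A] {C : Type*} [AddCommGroup C] [Module A C] [Module Aᵐᵒᵖ C]
  [SMulCommClass A Aᵐᵒᵖ C]

/-- The map `X ⊗_A θ : X ⊗_A C → X`, `x ⊗ c ↦ x θ(c)`. -/
def contractLeft (X : Type*) [AddCommGroup X] [Module Aᵐᵒᵖ X] {P : Type*} [AddCommGroup P]
    [Module A P] (θ : LeftDual A P) : NTensor A X P →+ X :=
  (rid A X).comp (map A LinearMap.id θ)

@[simp] theorem contractLeft_tmul {X : Type*} [AddCommGroup X] [Module Aᵐᵒᵖ X] {P : Type*}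
    [AddCommGroup P] [Module A P] (θ : LeftDual A P) (x : X) (p : P) :
    contractLeft X θ (tmul A x p) = op (θ p) • x := rfl

theorem tmul_sum {X : Type*} [AddCommGroup X] [Module Aᵐᵒᵖ X] {P : Type*} [AddCommGroup P]
    [Module A P] {κ : Type*} (s : Finset κ) (x : X) (p : κ → P) :
    tmul A x (∑ k ∈ s, p k) = ∑ k ∈ s, tmul A x (p k) :=
  map_sum (mk A X P x) p s

/-- If `P` is projective, the maps `X ⊗_A θ` with `θ ∈ *P` separate the elements of `X ⊗_A P`. -/
theorem contractLeft_ext {X : Type*} [AddCommGroup X] [Module Aᵐᵒᵖ X] {P : Type*} [AddCommGroup P]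
    [Module A P] [Module.Projective A P] {s t : NTensor A X P}
    (h : ∀ θ : LeftDual A P, contractLeft X θ s = contractLeft X θ t) : s = t := by
  classical
  obtain ⟨f, hf⟩ := (Module.projective_def (R := A) (P := P)).1 inferInstance
  -- The section `f` of the free cover gives coordinates indexed by the points of `P` itself, as in
  -- a possibly infinite dual basis. Asking for all `S' ⊇ S` lets two elements be expanded over one
  -- common index set.
  have key : ∀ t : NTensor A X P, ∃ S : Finset P, ∀ S', S ⊆ S' →
      t = ∑ p ∈ S', tmul A (contractLeft X (Finsupp.lapply p ∘ₗ f) t) p := by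
    intro t
    induction t using induction_on with
    | tm x p =>
      refine ⟨(f p).support, fun S' hS => ?_⟩
      conv_lhs => rw [← hf p, Finsupp.linearCombination_apply,
        Finsupp.sum_of_support_subset _ hS _ (fun i _ => by simp), tmul_sum]
      simp [op_smul_tmul]
    | add s t hs ht =>
      obtain ⟨S, hS⟩ := hs
      obtain ⟨T, hT⟩ := ht
      refine ⟨S ∪ T, fun S' h => ?_⟩
      conv_lhs => rw [hS S' (Finset.union_subset_left h), hT S' (Finset.union_subset_right h)]
      simp [add_tmul, Finset.sum_add_distrib]
  obtain ⟨S, hS⟩ := key s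
  obtain ⟨T, hT⟩ := key t
  rw [hS (S ∪ T) Finset.subset_union_left, hT (S ∪ T) Finset.subset_union_right]
  simp only [h]

theorem contract_map {P Q : Type*} [AddCommGroup P] [Module A P] [AddCommGroup Q] [Module A Q]
    (θ : LeftDual A Q) (g : P →ₗ[A] Q) (t : NTensor A C P) :
    contract C θ (map A LinearMap.id g t) = contract C (θ ∘ₗ g) t := by
  induction t using induction_on with
  | tm m n => simp
  | add s t hs ht => simp only [map_add, hs, ht]

variable [Coring A C]

/-- The endomorphism of the left comodule `C` given by a functional `θ`. -/
def endOfDual (θ : LeftDual A C) : leftEnd A C := ⟨op (hat C θ), fun c => (map_id_hat C θ c).symm⟩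

/-- In Sweedler notation, `ε(c₁ θ(c₂)) = ε(c₁) θ(c₂) = θ(ε(c₁) c₂) = θ(c)`. Hence every functional
on `C` is `⟨-, b⟩` for a colinear `b`. -/
theorem counit_hat (θ : LeftDual A C) (c : C) :
    (counit (A := A) (C := C)).left (hat C θ c) = θ c := by
  have h := congrArg θ (Coring.counit_left (A := A) c)
  rw [← h]
  change (counit (A := A) (C := C)).left (contract C θ ((comul (A := A) (C := C)).left c)) = _
  generalize (comul (A := A) (C := C)).left c = t
  induction t using induction_on with
  | tm m n => simp [← BimodHom.right_apply]
  | add s t hs ht => simp only [map_add, hs, ht]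

@[simp] theorem canonicalForm_endOfDual (θ : LeftDual A C) (c : C) :
    canonicalForm A C c (endOfDual θ) = θ c := counit_hat θ c

theorem leftEnd_ext {b b' : leftEnd A C}
    (h : ∀ c, leftEnd.toEnd b c = leftEnd.toEnd b' c) : b = b' :=
  Subtype.ext (unop_injective (LinearMap.ext h))

/-- The canonical form is nondegenerate in the second variable. -/
theorem canonicalForm_ext {b b' : leftEnd A C}
    (h : ∀ c, canonicalForm A C c b = canonicalForm A C c b') : b = b' := by
  refine leftEnd_ext fun c => ?_
  -- A colinear endomorphism is recovered from its composite with the counit: `b(c) = c₁ ε(b(c₂))`.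
  rw [toEnd_apply_eq_hat, toEnd_apply_eq_hat b']
  congr 2
  ext c
  exact h c

theorem canonicalForm_mul (c : C) (b b' : leftEnd A C) :
    canonicalForm A C c (b * b') = canonicalForm A C (leftEnd.toEnd b c) b' := rfl

variable (A C) in
-- Evaluating `α_X(t)` at the endomorphism attached to `θ` yields `(X ⊗ θ)(t)`, and these
-- contractions separate tensors over a projective module.
theorem canonicalPairing_isRightRational [Module.Projective A C] :
    (canonicalPairing A C).IsRightRational.{w} := by
  intro X _ _ s t hst
  refine contractLeft_ext fun θ => ?_
  have h : ∀ t : NTensor A X C,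
      contractLeft X θ t = (canonicalPairing A C).alpha X t (endOfDual θ) := by
    intro t
    induction t using induction_on with
    | tm x c =>
      change op (θ c) • x = op (canonicalForm A C c (endOfDual θ)) • x
      rw [canonicalForm_endOfDual]
    | add s t hs ht => simp only [map_add, hs, ht, AddMonoidHom.add_apply]
  rw [h, h, hst]

omit [Module Aᵐᵒᵖ C] [SMulCommClass A Aᵐᵒᵖ C] [Coring A C] in
theorem projective_of_isInternal {ι : Type*} [DecidableEq ι] {E : ι → Submodule A C}
    (hdec : DirectSum.IsInternal E)
    [∀ i, Module.Projective A (E i)] : Module.Projective A C :=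
  Module.Projective.of_equiv
    (LinearEquiv.ofBijective (DirectSum.coeLinearMap E) (internal_bijective hdec))

end Rational

/-! ### Local units: rationality through the idempotents, generation, purity, exactness -/

section Idempotents

variable {A : Type*} [Ring A] {C : Type*} [AddCommGroup C] [Module A C] [Module Aᵐᵒᵖ C]
  [SMulCommClass A Aᵐᵒᵖ C] [Coring A C] {ι : Type*} [DecidableEq ι] {E : ι → Submodule A C}
  [∀ i, LeftComodule A C (E i)]
  (hsub : ∀ i, IsLeftColinear A C (E i).subtype) (hdec : DirectSum.IsInternal E)

/-- The sum of the idempotents `e_i` for `i ∈ F`. -/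
noncomputable def sumIdem (F : Finset ι) : leftEnd A C := ∑ i ∈ F, decIdem hdec hsub i

theorem toEnd_decIdem (i : ι) (c : C) :
    leftEnd.toEnd (decIdem hdec hsub i) c = projTo hdec i c := rfl

theorem toEnd_sumIdem (F : Finset ι) (c : C) :
    leftEnd.toEnd (sumIdem hsub hdec F) c = ∑ i ∈ F, (projTo hdec i c : C) := by
  have h : ∀ b b' : leftEnd A C, leftEnd.toEnd (b + b') c = leftEnd.toEnd b c + leftEnd.toEnd b' c :=
    fun _ _ => rfl
  classical
  induction F using Finset.induction_on with
  | empty => rfl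
  | insert i F hi ih =>
    rw [sumIdem, Finset.sum_insert hi, Finset.sum_insert hi, h, ← ih]
    rfl

/-- Every element of `C` is fixed by almost all of the idempotents `∑_{i ∈ F} e_i`. -/
theorem exists_sumIdem_apply_eq (c : C) :
    ∃ F : Finset ι, ∀ F', F ⊆ F' → leftEnd.toEnd (sumIdem hsub hdec F') c = c := by
  obtain ⟨x, rfl⟩ := hdec.2 c
  induction x using DirectSum.induction_on with
  | zero => exact ⟨∅, fun F' _ => by simp⟩
  | of j x =>
    refine ⟨{j}, fun F' h => ?_⟩
    rw [DirectSum.coeAddMonoidHom_of, toEnd_sumIdem,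
      Finset.sum_eq_single_of_mem j (h (Finset.mem_singleton_self j))]
    · rw [projTo_self]
    · intro i _ hi
      rw [projTo_ne hdec hi.symm, Submodule.coe_zero]
  | add x y hx hy =>
    obtain ⟨F, hF⟩ := hx
    obtain ⟨G, hG⟩ := hy
    refine ⟨F ∪ G, fun F' h => ?_⟩
    rw [map_add, map_add, hF F' (Finset.union_subset_left h),
      hG F' (Finset.union_subset_right h)]

/-- Every rational element is fixed by almost all of the idempotents `∑_{i ∈ F} e_i`. -/
theorem exists_sumIdem_smul_eq {X : Type*} [AddCommGroup X] [Module (leftEnd A C)ᵐᵒᵖ X] {x : X}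
    (hx : (canonicalPairing A C).IsRational x) :
    ∃ F : Finset ι, ∀ F', F ⊆ F' → op (sumIdem hsub hdec F') • x = x := by
  obtain ⟨n, c, y, h⟩ := hx
  choose F hF using fun k => exists_sumIdem_apply_eq hsub hdec (c k)
  refine ⟨Finset.univ.biUnion F, fun F' hF' => ?_⟩
  -- Writing `x = x · 1` reduces the claim to `⟨cₖ, e_F'⟩ = ⟨cₖ, 1⟩` for each parameter `cₖ`.
  conv_rhs => rw [← one_smul (leftEnd A C)ᵐᵒᵖ x, ← op_one, h]
  rw [h]
  refine Finset.sum_congr rfl fun k _ => ?_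
  have hk : (canonicalPairing A C).form (c k) (sumIdem hsub hdec F') =
      (canonicalPairing A C).form (c k) 1 := by
    change (counit (A := A) (C := C)).left _ = (counit (A := A) (C := C)).left _
    rw [hF k F' ((Finset.subset_biUnion_of_mem F (Finset.mem_univ k)).trans hF')]
    rfl
  rw [hk]

/-- With a finite dual basis `(xₖ, θₖ)` of `E_i`, one has `⟨c, e_i b⟩ = ⟨π_i c, b⟩ = ∑ θₖ(π_i c)⟨xₖ,
b⟩`. Thus the `xₖ` are the parameters in `C`, and the endomorphisms representing `θₖ ∘ π_i` are
those in `B`. -/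
theorem isRational_decIdem (i : ι) [Module.Finite A (E i)] [Module.Projective A (E i)] :
    (canonicalPairing A C).IsRational (decIdem hdec hsub i) := by
  obtain ⟨n, e, f, hef⟩ := exists_dualBasis (A := A) (P := E i)
  refine ⟨n, fun k => e k, fun k => endOfDual (f k ∘ₗ projTo hdec i), fun b => ?_⟩
  refine canonicalForm_ext fun c => ?_
  change canonicalForm A C c (decIdem hdec hsub i * b) =
    canonicalForm A C c (∑ k, endOfDual (f k ∘ₗ projTo hdec i) *
      rightMulHom A C (canonicalForm A C (e k) b))
  rw [canonicalForm_mul, toEnd_decIdem, ← hef (projTo hdec i c), map_sum]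
  simp only [AddSubmonoidClass.coe_finsetSum, Submodule.coe_smul, map_sum,
    AddMonoidHom.finsetSum_apply]
  refine Finset.sum_congr rfl fun k _ => ?_
  exact ((canonicalPairing A C).form_smul _ _ _).trans
    (((canonicalPairing A C).form_mul_unit c (endOfDual (f k ∘ₗ projTo hdec i)) _).trans
      (congrArg (· * _) (canonicalForm_endOfDual _ c))).symm

variable [∀ i, Module.Finite A (E i)] [∀ i, Module.Projective A (E i)]

theorem sumIdem_mem_rationalIdeal (F : Finset ι) :
    sumIdem hsub hdec F ∈ (canonicalPairing A C).rationalIdeal :=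
  sum_mem fun i _ => isRational_decIdem hsub hdec i

/-- The map `b ↦ x b` from `B` to `X` is right linear, and linear maps preserve rational elements.
-/
theorem isRational_of_smul_eq {X : Type*} [AddCommGroup X] [Module (leftEnd A C)ᵐᵒᵖ X] {x : X}
    {b : leftEnd A C} (hb : b ∈ (canonicalPairing A C).rationalIdeal) :
    (canonicalPairing A C).IsRational (op b • x) :=
  Pairing.IsRational.map _ (X := leftEnd A C)
    { toFun := fun b => op b • x
      map_add' := fun b b' => by rw [op_add, add_smul]
      map_smul' := fun b b' => mul_smul b (op b') x } hb

/-- An element is rational if and only if it is fixed by one of the idempotents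
`∑_{i ∈ F} e_i`. -/
theorem isRational_iff {X : Type*} [AddCommGroup X] [Module (leftEnd A C)ᵐᵒᵖ X] {x : X} :
    (canonicalPairing A C).IsRational x ↔ ∃ F : Finset ι, op (sumIdem hsub hdec F) • x = x := by
  refine ⟨fun h => ?_, fun ⟨F, hF⟩ => ?_⟩
  · obtain ⟨F, hF⟩ := exists_sumIdem_smul_eq hsub hdec h
    exact ⟨F, hF F subset_rfl⟩
  · rw [← hF]
    exact isRational_of_smul_eq (sumIdem_mem_rationalIdeal hsub hdec F)

/-- A rational `x` equals `x e_F = ∑ x e_i`; conversely each `e_i` lies in the two-sided ideal `𝔞`.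
-/
theorem rationalIdeal_eq_closure :
    (canonicalPairing A C).rationalIdeal.toAddSubgroup =
      AddSubgroup.closure {x | ∃ (i : ι) (b b' : leftEnd A C),
        x = b * decIdem hdec hsub i * b'} := by
  refine le_antisymm (fun x hx => ?_) ((AddSubgroup.closure_le _).2 ?_)
  · obtain ⟨F, hF⟩ := (isRational_iff hsub hdec).1
      (show (canonicalPairing A C).IsRational x from hx)
    rw [← hF]
    change x * sumIdem hsub hdec F ∈ _
    rw [sumIdem, Finset.mul_sum]
    exact sum_mem fun i _ => AddSubgroup.subset_closure ⟨i, x, 1, (mul_one _).symm⟩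
  · rintro _ ⟨i, b, b', rfl⟩
    exact Ideal.mul_mem_right _ _ (Ideal.mul_mem_left _ _ (isRational_decIdem hsub hdec i))

include hsub hdec in
-- For `a ∈ 𝔞` and large `F`, `x ⊗ a = x ⊗ a e_F = x a ⊗ e_F`. So a tensor is determined by its
-- image under `X ⊗_B 𝔞 → X ⊗_B B → X`, which already makes the first map injective.
theorem isPure_rationalIdeal : IsPure.{w} (canonicalPairing A C).rationalIdeal := by
  intro X _ _
  refine (injective_iff_map_eq_zero _).2 fun t ht => ?_
  -- The statement for all `F' ⊇ F` makes it additive in `t`: two summands can use the same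
  -- idempotent.
  have key : ∀ t : NTensor (leftEnd A C) X (canonicalPairing A C).rationalIdeal,
      ∃ F : Finset ι, ∀ F', F ⊆ F' →
        t = tmul (leftEnd A C) (rid (leftEnd A C) X (NTensor.map (leftEnd A C) LinearMap.id
          (canonicalPairing A C).rationalIdeal.subtype t))
          ⟨sumIdem hsub hdec F', sumIdem_mem_rationalIdeal hsub hdec F'⟩ := by
    intro t
    induction t using induction_on with
    | tm x a =>
      obtain ⟨F, hF⟩ := exists_sumIdem_smul_eq hsub hdec
        (show (canonicalPairing A C).IsRational (a : leftEnd A C) from a.2)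
      refine ⟨F, fun F' h => ?_⟩
      rw [map_tmul, rid_tmul, op_smul_tmul, LinearMap.id_apply]
      congr 1
      exact Subtype.ext (hF F' h).symm
    | add s t hs ht =>
      obtain ⟨F, hF⟩ := hs
      obtain ⟨G, hG⟩ := ht
      refine ⟨F ∪ G, fun F' h => ?_⟩
      conv_lhs => rw [hF F' (Finset.union_subset_left h), hG F' (Finset.union_subset_right h)]
      simp only [map_add, add_tmul]
  obtain ⟨F, hF⟩ := key t
  rw [hF F subset_rfl, ht, map_zero, zero_tmul]

include hsub hdec in
open CategoryTheory in
-- Only the existence of rational preimages needs an argument: if `x e_F = x` and `y` maps to `x`,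
-- then `y e_F` is rational and still maps to `x`. This serves both exactness in the middle and
-- surjectivity.
theorem ratFunctor_shortExact (S : ShortComplex (ModuleCat.{w} (leftEnd A C)ᵐᵒᵖ))
    (hS : S.ShortExact) : (S.map (canonicalPairing A C).ratFunctor).ShortExact := by
  have hf : Function.Injective S.f.hom := (ModuleCat.mono_iff_injective _).1 hS.mono_f
  have hg : Function.Surjective S.g.hom := (ModuleCat.epi_iff_surjective _).1 hS.epi_g
  have he := (ShortComplex.moduleCat_exact_iff S).1 hS.exact
  refine ShortComplex.ShortExact.mk' ?_ ?_ ?_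
  · rw [ShortComplex.moduleCat_exact_iff]
    rintro ⟨x, hx⟩ hgx
    obtain ⟨y, hy⟩ := he x (congrArg Subtype.val hgx)
    obtain ⟨F, hF⟩ := (isRational_iff hsub hdec).1
      (show (canonicalPairing A C).IsRational x from hx)
    refine ⟨⟨op (sumIdem hsub hdec F) • y,
      isRational_of_smul_eq (sumIdem_mem_rationalIdeal hsub hdec F)⟩, Subtype.ext ?_⟩
    change S.f.hom (op (sumIdem hsub hdec F) • y) = x
    rw [map_smul, ← hF]
    exact congrArg _ hy
  · refine (ModuleCat.mono_iff_injective _).2 fun x y h => Subtype.ext (hf ?_)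
    exact congrArg Subtype.val h
  · refine (ModuleCat.epi_iff_surjective _).2 ?_
    rintro ⟨x, hx⟩
    obtain ⟨y, rfl⟩ := hg x
    obtain ⟨F, hF⟩ := (isRational_iff hsub hdec).1
      (show (canonicalPairing A C).IsRational (S.g.hom y) from hx)
    refine ⟨⟨op (sumIdem hsub hdec F) • y,
      isRational_of_smul_eq (sumIdem_mem_rationalIdeal hsub hdec F)⟩, Subtype.ext ?_⟩
    change S.g.hom (op (sumIdem hsub hdec F) • y) = S.g.hom y
    rw [map_smul, hF]

end Idempotents

/-! ## Duality between left colinear and right colinear maps -/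

section Duality

variable {A : Type*} [Ring A] {C : Type*} [AddCommGroup C] [Module A C] [Module Aᵐᵒᵖ C]
  [SMulCommClass A Aᵐᵒᵖ C]

/-- The dual `θ ↦ θ ∘ g` of a left linear map. -/
def dualMap {P Q : Type*} [AddCommGroup P] [Module A P] [AddCommGroup Q] [Module A Q]
    (g : P →ₗ[A] Q) : LeftDual A Q →ₗ[Aᵐᵒᵖ] LeftDual A P where
  toFun θ := θ ∘ₗ g
  map_add' _ _ := rfl
  map_smul' _ _ := rfl

@[simp] theorem dualMap_apply {P Q : Type*} [AddCommGroup P] [Module A P] [AddCommGroup Q]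
    [Module A Q] (g : P →ₗ[A] Q) (θ : LeftDual A Q) (x : P) : dualMap g θ x = θ (g x) := rfl

/-- Finitely generated projective modules are reflexive. -/
theorem dualMap_surjective {P Q : Type*} [AddCommGroup P] [Module A P] [AddCommGroup Q]
    [Module A Q] [Module.Finite A Q] [Module.Projective A Q]
    (t : LeftDual A Q →ₗ[Aᵐᵒᵖ] LeftDual A P) : ∃ g : P →ₗ[A] Q, dualMap g = t := by
  obtain ⟨n, e, f, hef⟩ := exists_dualBasis (A := A) (P := Q)
  -- The formula is forced: from `θ = ∑ fₖ θ(eₖ)`, right linearity gives `t(θ)(x) = ∑ t(fₖ)(x) θ(eₖ)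
  -- = θ(∑ t(fₖ)(x) eₖ)`.
  refine ⟨∑ k, (t (f k)).smulRight (e k), ?_⟩
  ext θ x
  have h : θ = ∑ k, op (θ (e k)) • f k := by
    ext y
    conv_lhs => rw [← hef y]
    simp
  conv_rhs => rw [h]
  simp

theorem evalAt_map_dualMap {P Q : Type*} [AddCommGroup P] [Module A P] [AddCommGroup Q]
    [Module A Q] (g : P →ₗ[A] Q) {N : Type*} [AddCommGroup N] [Module A N] (x : P)
    (s : NTensor A (LeftDual A Q) N) :
    evalAt N x (map A (dualMap g) LinearMap.id s) = evalAt N (g x) s := by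
  induction s using induction_on with
  | tm m n => simp
  | add s t hs ht => simp only [map_add, hs, ht]

/-- Functionals separate the points of a projective module. -/
theorem leftDual_ext {P : Type*} [AddCommGroup P] [Module A P] [Module.Projective A P] {x y : P}
    (h : ∀ θ : LeftDual A P, θ x = θ y) : x = y :=
  sub_eq_zero.1 ((Module.forall_dual_apply_eq_zero_iff A _).1 fun θ => by
    rw [map_sub, h, sub_self])

variable [Coring A C]

theorem IsLeftColinear.comp {P Q S : Type*} [AddCommGroup P] [Module A P] [LeftComodule A C P]
    [AddCommGroup Q] [Module A Q] [LeftComodule A C Q] [AddCommGroup S] [Module A S]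
    [LeftComodule A C S] {f : Q →ₗ[A] S} {g : P →ₗ[A] Q} (hf : IsLeftColinear A C f)
    (hg : IsLeftColinear A C g) : IsLeftColinear A C (f ∘ₗ g) := fun x => by
  rw [LinearMap.comp_apply, hf, hg, map_map]
  rfl

theorem IsRightColinear.comp {P Q S : Type*} [AddCommGroup P] [Module Aᵐᵒᵖ P]
    [RightComodule A C P] [AddCommGroup Q] [Module Aᵐᵒᵖ Q] [RightComodule A C Q] [AddCommGroup S]
    [Module Aᵐᵒᵖ S] [RightComodule A C S] {f : Q →ₗ[Aᵐᵒᵖ] S} {g : P →ₗ[Aᵐᵒᵖ] Q}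
    (hf : IsRightColinear A C f) (hg : IsRightColinear A C g) :
    IsRightColinear A C (f ∘ₗ g) := fun x => by
  rw [LinearMap.comp_apply, hf, hg, map_map]
  rfl

/-- A left linear map of profinite comodules is colinear if and only if its dual is. -/
theorem isRightColinear_dualMap_iff {P Q : Type*} [AddCommGroup P] [Module A P]
    [Module.Finite A P] [Module.Projective A P] [LeftComodule A C P] [AddCommGroup Q] [Module A Q]
    [Module.Finite A Q] [Module.Projective A Q] [LeftComodule A C Q] (g : P →ₗ[A] Q) :
    IsRightColinear A C (dualMap g) ↔ IsLeftColinear A C g := by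
  -- Evaluated at `x`, the two sides of right colinearity at `θ` become the contractions by `θ` of
  -- the two sides of left colinearity at `x`. Evaluations separate `*P ⊗_A C` and contractions
  -- separate `C ⊗_A Q`, so the two conditions coincide.
  have h1 : ∀ θ x, evalAt C x (dualCoact A P C (dualMap g θ)) =
      contract C θ (map A LinearMap.id g (LeftComodule.coact (A := A) (C := C) x)) := by
    intro θ x
    rw [evalAt_dualCoact, contract_map]
    rfl
  have h2 : ∀ θ x, evalAt C x (map A (dualMap g) LinearMap.id (dualCoact A Q C θ)) =
      contract C θ (LeftComodule.coact (A := A) (C := C) (g x)) := by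
    intro θ x
    rw [evalAt_map_dualMap, evalAt_dualCoact]
    rfl
  refine ⟨fun h x => contractLeft_ext fun θ => ?_, fun h θ => evalAt_ext fun x => ?_⟩
  · have h3 := congrArg (evalAt C x) (h θ)
    exact (h2 θ x).symm.trans (h3.symm.trans (h1 θ x))
  · exact (h1 θ x).trans ((congrArg (contract C θ) (h x).symm).trans (h2 θ x).symm)

end Duality

/-! ### Colinearity of the structure maps of a direct sum -/

section DirectSums

variable (A : Type*) [Ring A] (C : Type*) [AddCommGroup C] [Module A C] [Module Aᵐᵒᵖ C]
  [SMulCommClass A Aᵐᵒᵖ C] [Coring A C] {ι : Type*} [DecidableEq ι] (M : ι → Type*)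
  [∀ i, AddCommGroup (M i)] [∀ i, Module Aᵐᵒᵖ (M i)] [∀ i, RightComodule A C (M i)]

/-- The ring of right linear endomorphisms of `⨁ M_i`. -/
abbrev SumEnd {ι : Type*} (M : ι → Type*) [∀ i, AddCommGroup (M i)] [∀ i, Module Aᵐᵒᵖ (M i)] :
    Type _ := Module.End Aᵐᵒᵖ (⨁ i, M i)

theorem isRightColinear_lof (i : ι) : IsRightColinear A C (DirectSum.lof Aᵐᵒᵖ ι M i) :=
  sumCoact_lof A C M i

/-- The idempotent `u_i` is colinear and factors as inclusion after projection; applying the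
projection, a left inverse of the inclusion, cancels the latter in the colinearity identity. -/
theorem isRightColinear_component (i : ι) :
    IsRightColinear A C (DirectSum.component Aᵐᵒᵖ ι M i) := by
  have h0 : DirectSum.component Aᵐᵒᵖ ι M i ∘ₗ DirectSum.lof Aᵐᵒᵖ ι M i = LinearMap.id := by
    refine LinearMap.ext fun x => ?_
    rw [LinearMap.comp_apply, DirectSum.component.lof_self, LinearMap.id_apply]
  have h1 : DirectSum.component Aᵐᵒᵖ ι M i ∘ₗ unitIdem A M i =
      DirectSum.component Aᵐᵒᵖ ι M i := by
    rw [unitIdem, ← LinearMap.comp_assoc, h0, LinearMap.id_comp]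
  intro x
  have h : map A (DirectSum.component Aᵐᵒᵖ ι M i) LinearMap.id (RightComodule.coact (C := C)
      (unitIdem A M i x)) = map A _ LinearMap.id (map A (unitIdem A M i) LinearMap.id _) :=
    congrArg _ (unitIdem_mem A C M i x)
  rw [map_map, h1, LinearMap.id_comp, unitIdem, LinearMap.comp_apply, isRightColinear_lof,
    map_map, h0, LinearMap.id_comp, map_id] at h
  exact h

end DirectSums

/-! ## The embedding of `R` into the endomorphism ring -/

section Embedding

variable {A : Type*} [Ring A] {C : Type*} [AddCommGroup C] [Module A C]
  {ι : Type*} [DecidableEq ι] {E : ι → Submodule A C}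

@[simp] theorem toDual_lof (hdec : DirectSum.IsInternal E) (i : ι) (θ : LeftDual A (E i)) (c : C) :
    toDual hdec (DirectSum.lof Aᵐᵒᵖ ι (fun i => LeftDual A (E i)) i θ) c =
      θ (projTo hdec i c) := by
  have h : toDual hdec (DirectSum.of (fun i => LeftDual A (E i)) i θ) = θ ∘ₗ projTo hdec i :=
    DirectSum.toAddMonoid_of ..
  exact LinearMap.congr_fun h c

/-- On `E_i` every `π_j` with `j ≠ i` vanishes and `π_i` is the identity. So the components of an
element of `Σ` are restrictions of the functional it defines on `C`. -/
theorem component_apply_eq_toDual (hdec : DirectSum.IsInternal E) (i : ι)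
    (θ : ⨁ i, LeftDual A (E i)) (x : E i) :
    DirectSum.component Aᵐᵒᵖ ι (fun i => LeftDual A (E i)) i θ x = toDual hdec θ x := by
  induction θ using DirectSum.induction_on with
  | zero => simp
  | of j θ =>
    change DirectSum.component Aᵐᵒᵖ ι (fun i => LeftDual A (E i)) i
      (DirectSum.lof Aᵐᵒᵖ ι (fun i => LeftDual A (E i)) j θ) x =
      toDual hdec (DirectSum.lof Aᵐᵒᵖ ι (fun i => LeftDual A (E i)) j θ) x
    rw [toDual_lof]
    by_cases h : i = j
    · subst h
      rw [DirectSum.component.lof_self, projTo_self]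
    · rw [projTo_ne hdec h, map_zero, DirectSum.component.of, dif_neg (Ne.symm h)]
      rfl
  | add s t hs ht => rw [map_add, map_add, LinearMap.add_apply, LinearMap.add_apply, hs, ht]

theorem toDual_injective (hdec : DirectSum.IsInternal E) : Function.Injective (toDual hdec) := by
  intro s t h
  refine DirectSum.ext_component Aᵐᵒᵖ fun i => LinearMap.ext fun x => ?_
  rw [component_apply_eq_toDual hdec, component_apply_eq_toDual hdec, h]

/-- The part `Σ` of `*C` already separates points of `C`, since the functionals on each projective
`E_i` do. This is why `r` determines the endomorphism dual to it. -/
theorem eq_of_forall_toDual_eq (hdec : DirectSum.IsInternal E) [∀ i, Module.Projective A (E i)]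
    {c c' : C} (h : ∀ θ, toDual hdec θ c = toDual hdec θ c') : c = c' := by
  have h1 : ∀ i, projTo hdec i c = projTo hdec i c' := fun i => leftDual_ext fun θ => by
    rw [← toDual_lof, ← toDual_lof, h]
  refine (LinearEquiv.ofBijective (DirectSum.coeLinearMap E)
    (internal_bijective hdec)).symm.injective (DirectSum.ext_component A h1)

/-- The endomorphism of `⨁ *E_i` dual to `g : E_j → E_i`. -/
def dualEntry {i j : ι} (g : E j →ₗ[A] E i) :
    SumEnd A fun i => LeftDual A (E i) :=
  DirectSum.lof Aᵐᵒᵖ ι (fun i => LeftDual A (E i)) j ∘ₗ dualMap g ∘ₗ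
    DirectSum.component Aᵐᵒᵖ ι (fun i => LeftDual A (E i)) i

theorem toDual_dualEntry (hdec : DirectSum.IsInternal E) {i j : ι} (g : E j →ₗ[A] E i)
    (θ : ⨁ i, LeftDual A (E i)) (c : C) :
    toDual hdec (dualEntry g θ) c = toDual hdec θ (g (projTo hdec j c)) := by
  rw [dualEntry, LinearMap.comp_apply, toDual_lof, LinearMap.comp_apply, dualMap_apply,
    component_apply_eq_toDual hdec]

theorem unitIdem_mul_dualEntry_mul {i j : ι} (g : E j →ₗ[A] E i) :
    unitIdem A (fun i => LeftDual A (E i)) j * dualEntry g *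
      unitIdem A (fun i => LeftDual A (E i)) i = dualEntry g := by
  ext1 k
  refine LinearMap.ext fun θ => ?_
  simp only [unitIdem, dualEntry, Module.End.mul_apply, LinearMap.comp_apply,
    DirectSum.component.lof_self]

/-! ### The duality relation between elements of `R` and endomorphisms of `C` -/

variable [Module Aᵐᵒᵖ C] [SMulCommClass A Aᵐᵒᵖ C] [Coring A C] {hdec : DirectSum.IsInternal E}

variable (hdec) in
/-- The relation `r(θ) = θ ∘ b` between `R` and the endomorphism ring of `C`. -/
def IsDualTo (r : SumEnd A fun i => LeftDual A (E i)) (b : leftEnd A C) : Prop :=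
  ∀ θ c, toDual hdec (r θ) c = toDual hdec θ (leftEnd.toEnd b c)

theorem IsDualTo.add {r r' : SumEnd A fun i => LeftDual A (E i)} {b b' : leftEnd A C}
    (h : IsDualTo hdec r b) (h' : IsDualTo hdec r' b') : IsDualTo hdec (r + r') (b + b') := by
  intro θ c
  rw [LinearMap.add_apply, map_add, LinearMap.add_apply, h, h', ← map_add]
  rfl

theorem IsDualTo.neg {r : SumEnd A fun i => LeftDual A (E i)} {b : leftEnd A C}
    (h : IsDualTo hdec r b) : IsDualTo hdec (-r) (-b) := by
  intro θ c
  rw [LinearMap.neg_apply, map_neg, LinearMap.neg_apply, h, ← map_neg]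
  rfl

variable (hdec) in
theorem IsDualTo.zero : IsDualTo hdec 0 (0 : leftEnd A C) := fun θ c => by
  rw [LinearMap.zero_apply, map_zero]
  exact (map_zero (toDual hdec θ)).symm

/-- Dualizing reverses composition, and so does the opposite multiplication in `B`; the two
reversals cancel. -/
theorem IsDualTo.mul {r r' : SumEnd A fun i => LeftDual A (E i)} {b b' : leftEnd A C}
    (h : IsDualTo hdec r b) (h' : IsDualTo hdec r' b') : IsDualTo hdec (r * r') (b * b') :=
  fun _ _ => (h _ _).trans (h' _ _)

theorem IsDualTo.left_unique {r r' : SumEnd A fun i => LeftDual A (E i)} {b : leftEnd A C}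
    (h : IsDualTo hdec r b) (h' : IsDualTo hdec r' b) : r = r' :=
  LinearMap.ext fun θ => toDual_injective hdec <| LinearMap.ext fun c =>
    (h θ c).trans (h' θ c).symm

theorem IsDualTo.right_unique [∀ i, Module.Projective A (E i)]
    {r : SumEnd A fun i => LeftDual A (E i)} {b b' : leftEnd A C}
    (h : IsDualTo hdec r b) (h' : IsDualTo hdec r b') : b = b' :=
  leftEnd_ext fun c => eq_of_forall_toDual_eq hdec fun θ => (h θ c).symm.trans (h' θ c)

variable [∀ i, LeftComodule A C (E i)]
  (hsub : ∀ i, IsLeftColinear A C (E i).subtype)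

variable (hdec) in
include hsub in
theorem isLeftColinear_projTo (i : ι) : IsLeftColinear A C (projTo hdec i) := by
  have h0 : projTo hdec i ∘ₗ (E i).subtype = LinearMap.id :=
    LinearMap.ext fun x => projTo_self hdec i x
  intro c
  have h := congrArg (map A (LinearMap.id : C →ₗ[Aᵐᵒᵖ] C) (projTo hdec i))
    (projTo_colinear hdec hsub i c)
  rw [LinearMap.comp_apply, hsub, map_map, h0, LinearMap.id_comp, map_id, map_map,
    ← LinearMap.comp_assoc, h0, LinearMap.id_comp, LinearMap.id_comp] at h
  exact h

variable (hdec) in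
/-- The endomorphism of `C` induced by a colinear map `g : E_j → E_i`. -/
noncomputable def entry {i j : ι} (g : E j →ₗ[A] E i) (hg : IsLeftColinear A C g) : leftEnd A C :=
  ⟨op ((E i).subtype ∘ₗ g ∘ₗ projTo hdec j),
    (hsub i).comp (hg.comp (isLeftColinear_projTo hdec hsub j))⟩

theorem isDualTo_entry {i j : ι} (g : E j →ₗ[A] E i) (hg : IsLeftColinear A C g) :
    IsDualTo hdec (dualEntry g) (entry hdec hsub g hg) :=
  toDual_dualEntry hdec g

/-- Multiplying a matrix entry by any `b` and cutting off with `e_k` leaves a single entry `E_j →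
E_k`. It is the inductive brick for the stability of these endomorphisms under right multiplication.
-/
theorem entry_mul_mul_decIdem {i j k : ι} (g : E j →ₗ[A] E i) (hg : IsLeftColinear A C g)
    (b : leftEnd A C) :
    ∃ (g' : E j →ₗ[A] E k) (hg' : IsLeftColinear A C g'),
      entry hdec hsub g hg * b * decIdem hdec hsub k = entry hdec hsub g' hg' :=
  ⟨projTo hdec k ∘ₗ leftEnd.toEnd b ∘ₗ (E i).subtype ∘ₗ g,
    (isLeftColinear_projTo hdec hsub k).comp (IsLeftColinear.comp b.2 ((hsub i).comp hg)), rfl⟩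

theorem entry_mul_decIdem {i j : ι} (g : E j →ₗ[A] E i) (hg : IsLeftColinear A C g) :
    entry hdec hsub g hg * decIdem hdec hsub i = entry hdec hsub g hg :=
  leftEnd_ext fun c => congrArg Subtype.val (projTo_self hdec i (g (projTo hdec j c)))

variable [∀ i, Module.Finite A (E i)] [∀ i, Module.Projective A (E i)]

theorem dualEntry_mem_idemRing {i j : ι} (g : E j →ₗ[A] E i) (hg : IsLeftColinear A C g) :
    dualEntry g ∈ idemRing A C fun i => LeftDual A (E i) :=
  AddSubgroup.subset_closure ⟨i, j, dualEntry g,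
    (isRightColinear_lof A C _ j).comp (((isRightColinear_dualMap_iff g).2 hg).comp
      (isRightColinear_component A C _ i)), (unitIdem_mul_dualEntry_mul g).symm⟩

/-- The compression of `t` to a map `*E_i → *E_j` is the dual of some `g` by reflexivity, and `g`
inherits colinearity from the compression. So the generators of `R` are exactly dual matrix entries.
-/
theorem exists_dualEntry_eq {i j : ι} {t : SumEnd A fun i => LeftDual A (E i)}
    (ht : IsRightColinear A C t) :
    ∃ g : E j →ₗ[A] E i, IsLeftColinear A C g ∧
      unitIdem A (fun i => LeftDual A (E i)) j * t *
        unitIdem A (fun i => LeftDual A (E i)) i = dualEntry g := by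
  obtain ⟨g, hg⟩ := dualMap_surjective
    (DirectSum.component Aᵐᵒᵖ ι (fun i => LeftDual A (E i)) j ∘ₗ t ∘ₗ
      DirectSum.lof Aᵐᵒᵖ ι (fun i => LeftDual A (E i)) i)
  refine ⟨g, (isRightColinear_dualMap_iff g).1 ?_, ?_⟩
  · rw [hg]
    exact (isRightColinear_component A C _ j).comp
      (ht.comp (isRightColinear_lof A C _ i))
  · rw [dualEntry, hg]
    rfl

theorem entry_mem_rationalIdeal {i j : ι} (g : E j →ₗ[A] E i) (hg : IsLeftColinear A C g) :
    entry hdec hsub g hg ∈ (canonicalPairing A C).rationalIdeal := by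
  rw [← entry_mul_decIdem]
  exact Ideal.mul_mem_left _ _ (isRational_decIdem hsub hdec i)

/-- The product may spread over infinitely many summands a priori, but being rational it equals its
product with some `e_F`, hence is a finite sum of matrix entries. -/
theorem exists_isDualTo_entry_mul {i j : ι} (g : E j →ₗ[A] E i) (hg : IsLeftColinear A C g)
    (b : leftEnd A C) :
    ∃ s ∈ idemRing A C fun i => LeftDual A (E i), IsDualTo hdec s (entry hdec hsub g hg * b) := by
  obtain ⟨F, hF⟩ := (isRational_iff hsub hdec).1
    (show (canonicalPairing A C).IsRational (entry hdec hsub g hg * b) from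
      Ideal.mul_mem_right b _ (entry_mem_rationalIdeal hsub g hg))
  rw [← hF]
  change ∃ s ∈ idemRing A C fun i => LeftDual A (E i),
    IsDualTo hdec s (entry hdec hsub g hg * b * sumIdem hsub hdec F)
  rw [sumIdem, Finset.mul_sum]
  refine Finset.sum_induction _ (fun b => ∃ s ∈ idemRing A C fun i => LeftDual A (E i),
    IsDualTo hdec s b) ?_ ⟨0, zero_mem _, .zero hdec⟩ fun k _ => ?_
  · rintro b b' ⟨s, hs, h⟩ ⟨s', hs', h'⟩
    exact ⟨s + s', add_mem hs hs', h.add h'⟩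
  · obtain ⟨g', hg', h⟩ := entry_mul_mul_decIdem (k := k) (hdec := hdec) hsub g hg b
    rw [h]
    exact ⟨_, dualEntry_mem_idemRing g' hg', isDualTo_entry hsub g' hg'⟩

variable (hdec) in
include hsub in
/-- The elements of the endomorphism ring dual to an element of `R` form a right ideal contained
in the rational ideal. -/
theorem exists_isDualTo_of_mem {r : SumEnd A fun i => LeftDual A (E i)}
    (hr : r ∈ idemRing A C fun i => LeftDual A (E i)) :
    ∃ b : leftEnd A C, IsDualTo hdec r b ∧ b ∈ (canonicalPairing A C).rationalIdeal ∧
      ∀ b', ∃ s ∈ idemRing A C fun i => LeftDual A (E i), IsDualTo hdec s (b * b') := by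
  change r ∈ AddSubgroup.closure _ at hr
  induction hr using AddSubgroup.closure_induction with
  | zero =>
    refine ⟨0, .zero hdec, zero_mem _, fun b' => ⟨0, zero_mem _, ?_⟩⟩
    rw [zero_mul]
    exact .zero hdec
  | add x y _ _ hx hy =>
    obtain ⟨b, hb, hba, hbm⟩ := hx
    obtain ⟨c, hc, hca, hcm⟩ := hy
    refine ⟨b + c, hb.add hc, add_mem hba hca, fun b' => ?_⟩
    obtain ⟨s, hs, hsb⟩ := hbm b'
    obtain ⟨t, ht, htc⟩ := hcm b'
    refine ⟨s + t, add_mem hs ht, ?_⟩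
    rw [add_mul]
    exact hsb.add htc
  | neg x _ hx =>
    obtain ⟨b, hb, hba, hbm⟩ := hx
    refine ⟨-b, hb.neg, neg_mem hba, fun b' => ?_⟩
    obtain ⟨s, hs, hsb⟩ := hbm b'
    refine ⟨-s, neg_mem hs, ?_⟩
    rw [neg_mul]
    exact hsb.neg
  | mem x hx =>
    obtain ⟨i, j, t, ht, rfl⟩ := hx
    obtain ⟨g, hg, h⟩ := exists_dualEntry_eq (i := i) (j := j) ht
    rw [h]
    exact ⟨_, isDualTo_entry hsub g hg, entry_mem_rationalIdeal hsub g hg,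
      exists_isDualTo_entry_mul hsub g hg⟩

variable (hdec) in
include hsub hdec in
/-- An additive group embedded as a right ideal contained in the rational ideal is a rational
module. -/
theorem exists_module_of_injective {R : Type*} [AddCommGroup R] (f : R →+ leftEnd A C)
    (hf : Function.Injective f) (hmul : ∀ r b, ∃ s, f s = f r * b)
    (hrat : ∀ r, f r ∈ (canonicalPairing A C).rationalIdeal) :
    ∃ (_ : Module (leftEnd A C)ᵐᵒᵖ R)
      (j : R →ₗ[(leftEnd A C)ᵐᵒᵖ] (canonicalPairing A C).rat (leftEnd A C)),
      (canonicalPairing A C).rat R = ⊤ ∧ ∀ r, (j r : leftEnd A C) = f r := by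
  choose m hm using hmul
  let _ : SMul (leftEnd A C)ᵐᵒᵖ R := ⟨fun b r => m r b.unop⟩
  -- The chosen `m r b` satisfies `f (m r b) = f r * b`, so the module axioms pull back along the
  -- injective `f`.
  let _ : Module (leftEnd A C)ᵐᵒᵖ R := hf.module _ f fun b r => hm r b.unop
  refine ⟨inferInstance,
    { toFun := fun r => ⟨f r, hrat r⟩
      map_add' := fun r s => Subtype.ext (map_add f r s)
      map_smul' := fun b r => Subtype.ext (hm r b.unop) }, ?_, fun r => rfl⟩
  refine eq_top_iff.2 fun r _ => ?_
  obtain ⟨F, hF⟩ := (isRational_iff hsub hdec).1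
    (show (canonicalPairing A C).IsRational (f r) from hrat r)
  -- The submodule `f(R)` of a rational module is rational by the idempotent criterion: `f r · e_F =
  -- f r` pulls back to `r e_F = r`.
  exact (isRational_iff hsub hdec).2 ⟨F, hf ((hm r _).trans hF)⟩

end Embedding

end NCoring

/-! ### Assembly of the main theorem -/

theorem mainTheorem4 {A : Type*} [Ring A] {C : Type*} [AddCommGroup C]
    [Module A C] [Module Aᵐᵒᵖ C] [SMulCommClass A Aᵐᵒᵖ C] [Coring A C]
    {ι : Type*} [DecidableEq ι] (E : ι → Submodule A C) [∀ i, LeftComodule A C (E i)]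
    [∀ i, Module.Finite A (E i)] [∀ i, Module.Projective A (E i)]
    (hsub : ∀ i, IsLeftColinear A C (E i).subtype) (hdec : DirectSum.IsInternal E) :
    -- the canonical pairing is a right rational pairing
    (canonicalPairing A C).IsRightRational.{w} ∧
    -- (a) `R` is a rational right module, embedded into the rational ideal
    (∃ (_ : Module (leftEnd A C)ᵐᵒᵖ (idemRing A C fun i => LeftDual A (E i)))
        (j : (idemRing A C fun i => LeftDual A (E i)) →ₗ[(leftEnd A C)ᵐᵒᵖ]
          (canonicalPairing A C).rat (leftEnd A C)),
      (canonicalPairing A C).rat (idemRing A C fun i => LeftDual A (E i)) = ⊤ ∧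
      Function.Injective j ∧
      (∀ r s, (j (r * s) : leftEnd A C) = (j r : leftEnd A C) * (j s : leftEnd A C)) ∧
      (∀ r θ c, toDual hdec (r.1 θ) c = toDual hdec θ (leftEnd.toEnd (j r : leftEnd A C) c))) ∧
    -- (b) generation by the idempotents, and purity
    (canonicalPairing A C).rationalIdeal.toAddSubgroup =
      AddSubgroup.closure {x | ∃ (i : ι) (b b' : leftEnd A C), x = b * decIdem hdec hsub i * b'} ∧
    IsPure.{w} (canonicalPairing A C).rationalIdeal ∧
    -- (c) exactness of the rational functor
    (∀ S : CategoryTheory.ShortComplex (ModuleCat.{w} (leftEnd A C)ᵐᵒᵖ),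
      S.ShortExact → (S.map (canonicalPairing A C).ratFunctor).ShortExact) := by
  have := projective_of_isInternal hdec
  refine ⟨canonicalPairing_isRightRational A C, ?_, rationalIdeal_eq_closure hsub hdec,
    isPure_rationalIdeal hsub hdec, ratFunctor_shortExact hsub hdec⟩
  -- The dual endomorphism of `r` is unique, so this choice is automatically additive and
  -- multiplicative; uniqueness of `r` for a given endomorphism makes it injective.
  choose f hf hrat hmul using
    fun r : idemRing A C fun i => LeftDual A (E i) => exists_isDualTo_of_mem hdec hsub r.2
  have hinj : Function.Injective f := fun r s h =>
    Subtype.ext ((hf r).left_unique (h ▸ hf s))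
  obtain ⟨inst, j, hR, hj⟩ := exists_module_of_injective hdec hsub
    (AddMonoidHom.mk' f fun r s => (hf (r + s)).right_unique ((hf r).add (hf s))) hinj
    (fun r b => by
      obtain ⟨s, hs, h⟩ := hmul r b
      exact ⟨⟨s, hs⟩, (hf ⟨s, hs⟩).right_unique h⟩) hrat
  refine ⟨inst, j, hR, fun r s h => hinj ?_, fun r s => ?_, fun r θ c => ?_⟩
  · exact (hj r).symm.trans ((congrArg Subtype.val h).trans (hj s))
  · rw [hj, hj, hj]
    exact (hf (r * s)).right_unique ((hf r).mul (hf s))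
  · rw [hj]
    exact hf r θ c
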